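/- Let $d\ge 2$ and let $r\ge 1$ be an integer with $r\notin\{1,2,4\}$. Regard $\mathbb{Z}^d$ as a graph in which $n,m$ are adjacent iff $\|n-m\|_1=1$; for a finite $F\subset\mathbb{Z}^d$ let $\partial F$ be the set of sites outside $F$ adjacent to a site of $F$. Let $X_r\subset(\mathbb{Z}/r\mathbb{Z})^{\mathbb{Z}^d}$ be the set of all configurations $(\hat x_n \bmod r)_{n\in\mathbb{Z}^d}$, where $\hat x:\mathbb{Z}^d\to\mathbb{Z}$ satisfies $|\hat x_n-\hat x_m|=1$ whenever $\|n-m\|_1=1$. For finite $F$ and a pattern $a$ on $F$ let $[a]_F$ be the cylinder set of all configurations $x$ with $x|_F=a$, and write $[x]_F=[x|_F]_F$. Let $(\sigma_n x)_m=x_{m+n}$ be the shift. *Markov random fields.* A Markov random field is a Borel probability measure $\mu$ on $(\mathbb{Z}/r\mathbb{Z})^{\mathbb{Z}^d}$ such that $\mu([a]_A\mid[b]_B)=\mu([a]_A\mid[b|_{\partial A}]_{\partial A})$ for all finite $A,B$ with $\partial A\subset B\subset A^c$ and all patterns $a$ on $A$, $b$ on $B$ with $\mu([b]_B)>0$. Let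 $\Delta_{X_r}$ be the set of pairs $(x,y)\in X_r\times X_r$ that differ at only finitely many sites. The field $\mu$ is adapted to $X_r$ if $\operatorname{supp}\mu\subset X_r$ and $x\in\operatorname{supp}\mu$, $(x,y)\in\Delta_{X_r}$ imply $y\in\operatorname{supp}\mu$. It is frozen if every $x\in\operatorname{supp}\mu$ lies in $X_r$ and is such that $(x,y)\in\Delta_{X_r}$ only for $y=x$. *Interactions.* An interaction $\phi$ on $X_r$ is a real function on the finite patterns that occur in points of $X_r$. It is nearest-neighbour if it vanishes on patterns on sets of diameter greater than $1$, and shift-invariant if $\phi(\sigma_n a)=\phi(a)$ for all $n$ and $a$. A Markov random field $\mu$ with $\operatorname{supp}\mu\subset X_r$ is a Gibbs state for a nearest-neighbour interaction $\phi$ if $$\mu([x]_A\mid[x]_B)=\frac{1}{Z_{A,x|_{\partial A}}}\prod_{C\subset A\cup\partial A}e^{\phi(x|_C)}$$ for all $x\in\operatorname{supp}\mu$ and all finite $A,B$ with $\partial A\subset B\subset A^c$, where $Z_{A,x|_{\partial A}}$ is the normalizing factor, i.e. the sum of $\prod_{C\subset A\cup\partial A}e^{\phi(w|_C)}$ over all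 patterns $w$ on $A\cup\partial A$ that occur in $\operatorname{supp}\mu$ and agree with $x$ on $\partial A$. *Cocycles.* A shift-invariant Markov cocycle on $X_r$ is a function $M:\Delta_{X_r}\to\mathbb{R}$ such that $M(x,z)=M(x,y)+M(y,z)$ and $M(\sigma_nx,\sigma_ny)=M(x,y)$, and such that $M(x,y)$ is determined by $x|_{F\cup\partial F}$ and $y|_{F\cup\partial F}$ whenever $F$ is finite and $x|_{F^c}=y|_{F^c}$. It is a shift-invariant Gibbs cocycle if, for some shift-invariant nearest-neighbour interaction $\phi$ on $X_r$, $M(x,y)=\sum_{W}\big(\phi(y|_W)-\phi(x|_W)\big)$ for all $(x,y)\in\Delta_{X_r}$, the sum being over all finite $W\subset\mathbb{Z}^d$. We say that $\mu$ has Radon–Nikodym cocycle $e^M$ on its support if $\mu([y]_\Lambda)/\mu([x]_\Lambda)=e^{M(x,y)}$ for all $(x,y)\in\Delta_{X_r}$ with $x,y\in\operatorname{supp}\mu$ and all finite $\Lambda\supset F\cup\partial F$, where $F=\{n: x_n\neq y_n\}$. **Theorem.** Let $\mu$ be a shift-invariant Markov random field on $(\mathbb{Z}/r\mathbb{Z})^{\mathbb{Z}^d}$.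 1. If $\mu$ is adapted to $X_r$, then $\mu$ is a Gibbs state for some shift-invariant nearest-neighbour interaction on $X_r$. 2. In particular, if $\operatorname{supp}\mu=X_r$, then $\mu$ is a Gibbs state for some shift-invariant nearest-neighbour interaction on $X_r$. 3. If $\mu$ is adapted to $X_r$ and has Radon–Nikodym cocycle $e^M$ on its support for some shift-invariant Markov cocycle $M$ on $X_r$ which is not a shift-invariant Gibbs cocycle, then $\mu$ is frozen. -/

import Mathlib

open MeasureTheory

namespace ZdField

/-- The lattice `ℤ^d`. -/
abbrev Lattice (d : ℕ) : Type := Fin d → ℤ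

/-- Configurations `𝒜^{ℤ^d}`, with the product topology and the product `σ`-algebra. -/
abbrev Config (d : ℕ) (𝒜 : Type*) : Type _ := Lattice d → 𝒜

/-- The `ℓ¹` distance on `ℤ^d`; it is the graph distance of the standard Cayley graph, in which
two sites are adjacent iff their distance is `1`. -/
def l1dist {d : ℕ} (n m : Lattice d) : ℤ := ∑ i, |n i - m i|

/-- The sites adjacent to `n`. -/
noncomputable def neighbors {d : ℕ} (n : Lattice d) : Finset (Lattice d) :=
  (Finset.Icc (n - 1) (n + 1)).filter fun m => l1dist n m = 1

theorem mem_neighbors {d : ℕ} {n m : Lattice d} : m ∈ neighbors n ↔ l1dist n m = 1 := by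
  simp only [neighbors, Finset.mem_filter, Finset.mem_Icc, and_iff_right_iff_imp]
  intro h
  have key : ∀ i, |n i - m i| ≤ 1 := fun i => by
    rw [← h]
    exact Finset.single_le_sum (f := fun i => |n i - m i|) (fun j _ => abs_nonneg _)
      (Finset.mem_univ i)
  constructor <;> intro i <;> have := abs_le.1 (key i) <;> simp <;> omega

/-- The (outer) boundary `∂F` of a finite set of sites. -/
noncomputable def boundary {d : ℕ} (F : Finset (Lattice d)) : Finset (Lattice d) :=
  F.biUnion neighbors \ F

theorem mem_boundary {d : ℕ} {F : Finset (Lattice d)} {m : Lattice d} :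
    m ∈ boundary F ↔ m ∉ F ∧ ∃ n ∈ F, l1dist n m = 1 := by
  simp [boundary, mem_neighbors, and_comm]

/-- The shift `(σ_n x)_m = x_{m+n}`. -/
def shift {d : ℕ} {𝒜 : Type*} (n : Lattice d) (x : Config d 𝒜) : Config d 𝒜 :=
  fun m => x (m + n)

/-- The cylinder set `[a]_F`. -/
def cyl {d : ℕ} {𝒜 : Type*} (F : Finset (Lattice d)) (a : F → 𝒜) : Set (Config d 𝒜) :=
  {x | F.restrict x = a}

/-- `ℬ_W(X)`: the patterns on `W` that occur in the points of `X`. -/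
def language {d : ℕ} {𝒜 : Type*} (X : Set (Config d 𝒜)) (W : Finset (Lattice d)) :
    Set (W → 𝒜) :=
  W.restrict '' X

/-- The pattern `x|_W` of a point `x ∈ X`. -/
def pat {d : ℕ} {𝒜 : Type*} {X : Set (Config d 𝒜)} (x : X) (W : Finset (Lattice d)) :
    language X W :=
  ⟨W.restrict (x : Config d 𝒜), (x : Config d 𝒜), x.2, rfl⟩

/-- The restriction `w|_C` of a pattern `w ∈ ℬ_W(X)` to `C ⊆ W`. -/
def subpat {d : ℕ} {𝒜 : Type*} {X : Set (Config d 𝒜)} {W C : Finset (Lattice d)}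
    (h : C ⊆ W) (w : language X W) : language X C :=
  ⟨Finset.restrict₂ (π := fun _ => 𝒜) h w.1, by
    obtain ⟨x, hx, hw⟩ := w.2
    exact ⟨x, hx, by rw [← hw]; rfl⟩⟩

/-! ### Markov random fields -/

/-- A Markov random field on `ℤ^d`: a probability measure with
`μ([a]_A | [b]_B) = μ([a]_A | [b|_{∂A}]_{∂A})` whenever `A, B` are finite, `∂A ⊆ B ⊆ Aᶜ` and
`μ([b]_B) > 0`. -/
structure IsMRF {d : ℕ} {𝒜 : Type*} [MeasurableSpace 𝒜] (μ : Measure (Config d 𝒜)) : Prop where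
  prob : IsProbabilityMeasure μ
  markov : ∀ (A B : Finset (Lattice d)) (hAB : boundary A ⊆ B), Disjoint A B →
    ∀ (a : A → 𝒜) (b : B → 𝒜), 0 < μ (cyl B b) →
      ProbabilityTheory.cond μ (cyl B b) (cyl A a) =
        ProbabilityTheory.cond μ (cyl (boundary A) (Finset.restrict₂ (π := fun _ => 𝒜) hAB b)) (cyl A a)

/-- Shift-invariance of a measure. -/
def ShiftInvariant {d : ℕ} {𝒜 : Type*} [MeasurableSpace 𝒜] (μ : Measure (Config d 𝒜)) : Prop :=
  ∀ n : Lattice d, MeasurePreserving (shift n) μ μ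

/-- The homoclinic relation `Δ_X`. -/
def homoclinic {d : ℕ} {𝒜 : Type*} (X : Set (Config d 𝒜)) : Set (Config d 𝒜 × Config d 𝒜) :=
  {p | p.1 ∈ X ∧ p.2 ∈ X ∧ {n | p.1 n ≠ p.2 n}.Finite}

/-- `μ` is adapted to `X`. -/
def Adapted {d : ℕ} {𝒜 : Type*} [TopologicalSpace 𝒜] [MeasurableSpace 𝒜]
    (μ : Measure (Config d 𝒜)) (X : Set (Config d 𝒜)) : Prop :=
  μ.support ⊆ X ∧ ∀ x ∈ μ.support, ∀ y, (x, y) ∈ homoclinic X → y ∈ μ.support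

/-- `x` is a frozen point of `X`: its homoclinic class in `X` is a singleton. -/
def FrozenPoint {d : ℕ} {𝒜 : Type*} (X : Set (Config d 𝒜)) (x : Config d 𝒜) : Prop :=
  x ∈ X ∧ ∀ y, (x, y) ∈ homoclinic X → y = x

/-- A measure on `X` is frozen if its support consists of frozen points of `X`. -/
def FrozenMeasure {d : ℕ} {𝒜 : Type*} [TopologicalSpace 𝒜] [MeasurableSpace 𝒜]
    (X : Set (Config d 𝒜)) (μ : Measure (Config d 𝒜)) : Prop :=
  ∀ x ∈ μ.support, FrozenPoint X x

/-! ### Interactions and Gibbs states -/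

/-- An interaction on `X`: a real function on the language of `X`. -/
def Interaction {d : ℕ} {𝒜 : Type*} (X : Set (Config d 𝒜)) : Type _ :=
  ∀ W : Finset (Lattice d), language X W → ℝ

/-- Nearest-neighbour interactions: `φ` vanishes on the patterns on sets of diameter `> 1`. -/
def Interaction.IsNearestNeighbor {d : ℕ} {𝒜 : Type*} {X : Set (Config d 𝒜)}
    (φ : Interaction X) : Prop :=
  ∀ (W : Finset (Lattice d)) (w : language X W),
    (∃ i ∈ W, ∃ j ∈ W, 1 < l1dist i j) → φ W w = 0

/-- Shift-invariance of an interaction on a subshift `X`: `φ(σ_n a) = φ(a)`, where for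
`a = x|_W` the pattern `σ_n a` is `(σ_n x)|_{W - n}`. -/
def Interaction.IsShiftInvariant {d : ℕ} {𝒜 : Type*} {X : Set (Config d 𝒜)}
    (φ : Interaction X) : Prop :=
  ∀ (n : Lattice d) (W : Finset (Lattice d)) (x y : X),
    (y : Config d 𝒜) = shift n (x : Config d 𝒜) →
      φ (W.image fun m => m - n) (pat y _) = φ W (pat x W)

/-- The weight `∏_{C ⊆ W} e^{φ(w|_C)}` of a pattern `w` on `W`. -/
noncomputable def Interaction.weight {d : ℕ} {𝒜 : Type*} {X : Set (Config d 𝒜)}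
    (φ : Interaction X) {W : Finset (Lattice d)} (w : language X W) : ℝ :=
  ∏ C ∈ W.powerset.attach, Real.exp (φ C.1 (subpat (Finset.mem_powerset.1 C.2) w))

open Classical in
/-- The normalizing factor `Z_{A, b}` for a boundary pattern `b` on `∂A`: the sum of the weights
of the patterns on `A ∪ ∂A` that occur in the set `S` (which will be the support of the field)
and extend `b`. -/
noncomputable def Interaction.partition {d : ℕ} {𝒜 : Type*} [Fintype 𝒜] {X : Set (Config d 𝒜)}
    (φ : Interaction X) (S : Set (Config d 𝒜)) (A : Finset (Lattice d)) (b : boundary A → 𝒜) : ℝ :=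
  ∑ w : language X (A ∪ boundary A),
    if w.1 ∈ language S (A ∪ boundary A) ∧ Finset.restrict₂ (π := fun _ => 𝒜) Finset.subset_union_right w.1 = b
    then φ.weight w else 0

/-- `μ` is a Gibbs state, supported in `X`, for the interaction `φ` on `X`. -/
structure IsGibbsState {d : ℕ} {𝒜 : Type*} [Fintype 𝒜] [TopologicalSpace 𝒜] [MeasurableSpace 𝒜]
    {X : Set (Config d 𝒜)} (φ : Interaction X) (μ : Measure (Config d 𝒜)) : Prop where
  isMRF : IsMRF μ
  support_subset : μ.support ⊆ X
  gibbs : ∀ (x : X), (x : Config d 𝒜) ∈ μ.support →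
    ∀ A B : Finset (Lattice d), boundary A ⊆ B → Disjoint A B →
      (ProbabilityTheory.cond μ (cyl B (B.restrict (x : Config d 𝒜)))).real
          (cyl A (A.restrict (x : Config d 𝒜))) =
        φ.weight (pat x (A ∪ boundary A)) /
          φ.partition μ.support A ((boundary A).restrict (x : Config d 𝒜))

/-! ### Markov cocycles and Gibbs cocycles -/

/-- Shift-invariant Markov cocycles on `X`: real functions `M` on `Δ_X` which satisfy the cocycle
equation, are such that for `x|_{Fᶜ} = y|_{Fᶜ}` the value `M(x,y)` is determined by
`x|_{F ∪ ∂F}` and `y|_{F ∪ ∂F}`, and are shift-invariant. -/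
structure IsShiftInvariantMarkovCocycle {d : ℕ} {𝒜 : Type*} {X : Set (Config d 𝒜)}
    (M : homoclinic X → ℝ) : Prop where
  cocycle : ∀ (x y z : Config d 𝒜) (hxy : (x, y) ∈ homoclinic X) (hyz : (y, z) ∈ homoclinic X)
    (hxz : (x, z) ∈ homoclinic X), M ⟨(x, z), hxz⟩ = M ⟨(x, y), hxy⟩ + M ⟨(y, z), hyz⟩
  markov : ∀ (F : Finset (Lattice d)) (x y z w : Config d 𝒜)
    (hxy : (x, y) ∈ homoclinic X) (hzw : (z, w) ∈ homoclinic X),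
    (∀ n ∉ F, x n = y n) → (∀ n ∉ F, z n = w n) →
    (∀ n ∈ F ∪ boundary F, x n = z n) → (∀ n ∈ F ∪ boundary F, y n = w n) →
      M ⟨(x, y), hxy⟩ = M ⟨(z, w), hzw⟩
  invariant : ∀ (n : Lattice d) (x y : Config d 𝒜) (hxy : (x, y) ∈ homoclinic X)
    (hs : (shift n x, shift n y) ∈ homoclinic X),
      M ⟨(shift n x, shift n y), hs⟩ = M ⟨(x, y), hxy⟩

/-- The Gibbs cocycle `M_φ(x,y) = ∑_W (φ(y|_W) - φ(x|_W))`, the sum running over all finite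
sets of sites. For a nearest-neighbour interaction only finitely many terms are nonzero. -/
noncomputable def gibbsCocycle {d : ℕ} {𝒜 : Type*} {X : Set (Config d 𝒜)} (φ : Interaction X) :
    homoclinic X → ℝ :=
  fun p => ∑ᶠ W : Finset (Lattice d), (φ W (pat ⟨p.1.2, p.2.2.1⟩ W) - φ W (pat ⟨p.1.1, p.2.1⟩ W))

/-- `M` is the Gibbs cocycle of a shift-invariant nearest-neighbour interaction on `X`. -/
def IsShiftInvariantGibbsCocycle {d : ℕ} {𝒜 : Type*} {X : Set (Config d 𝒜)}
    (M : homoclinic X → ℝ) : Prop :=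
  ∃ φ : Interaction X, φ.IsNearestNeighbor ∧ φ.IsShiftInvariant ∧ M = gibbsCocycle φ

/-- The Radon–Nikodym cocycle of `μ` is the restriction of `e^M` to the support of `μ`:
`μ([y]_Λ) / μ([x]_Λ) = e^{M(x,y)}` for all homoclinic `x, y` in the support and all finite
`Λ ⊇ F ∪ ∂F`, where `F` is the set of sites at which `x` and `y` differ. -/
def HasRadonNikodymCocycle {d : ℕ} {𝒜 : Type*} [TopologicalSpace 𝒜] [MeasurableSpace 𝒜]
    {X : Set (Config d 𝒜)} (μ : Measure (Config d 𝒜)) (M : homoclinic X → ℝ) : Prop :=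
  ∀ (x y : Config d 𝒜) (hxy : (x, y) ∈ homoclinic X), x ∈ μ.support → y ∈ μ.support →
    ∀ F Λ : Finset (Lattice d), (∀ n, n ∈ F ↔ x n ≠ y n) → F ∪ boundary F ⊆ Λ →
      μ.real (cyl Λ (Λ.restrict y)) / μ.real (cyl Λ (Λ.restrict x)) = Real.exp (M ⟨(x, y), hxy⟩)

/-! ### The subshifts `X_r` -/

/-- Height functions: graph homomorphisms from `ℤ^d` to `ℤ`. -/
def Ht (d : ℕ) : Set (Config d ℤ) :=
  {h | ∀ n m, l1dist n m = 1 → |h n - h m| = 1}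

/-- `X_r`, the set of reductions modulo `r` of the height functions. -/
def Xr (d r : ℕ) : Set (Config d (ZMod r)) :=
  (fun h n => (h n : ZMod r)) '' Ht d

end ZdField

namespace ZdField

/-! ### Geometry of the lattice -/

section Lattice

variable {d : ℕ}

/-! Colours lift to heights. Since `r` is not 1, 2 or 4, four steps `±1` around a unit square that
cancel modulo `r` cancel in `ℤ`. Hence `X_r` is defined by a nearest-neighbour constraint
(`mem_Xr_of_step`). As `d ≥ 2`, the outside of a box is connected, so homoclinic points have lifts
that agree off a finite set (`exists_lift_pair`).

Any two such lifts are joined through their maximum by moves that raise a local minimum by 2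
(`flip_induction`), so a shift-invariant Markov cocycle is determined by its values `m a` at flips
of colour `a`. The part of `m` of mean zero is a coboundary on `ℤ/r` and comes from an edge
interaction; the mean contributes `α` times the total change of height. Thus `M = α · (height
change) + Gibbs` (`markovCocycle_structure`), and the only obstruction to being Gibbs is `α`.

For the measure there is a dichotomy, according to the points with steps of both signs on every
coordinate ray (`oscillating`). If they form a null set, Poincaré recurrence makes almost every
point monotone in a whole coordinate direction; such a point has extremal slope there and cannot be
changed at finitely many sites, so the field is frozen and the zero interaction serves.

If they have positive measure, then with probability at least some `ε`, uniformly in the scale, both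
signs occur with positive frequency on all axes (`exists_stepCount_bound`). The height then stays
linearly far from its Lipschitz extremes on the sphere of radius `N`. This slack has two uses. Any
pattern can be implanted by a finite change, so an adapted field has full support and its
Radon–Nikodym cocycle lives on all of `X_r`. Also, a cone can be inserted that changes the total
height by order `N^(d+1)`; if `α ≠ 0`, each relevant cylinder on the box has mass at most
`exp(O(N^d) - const · N^(d+1))`, and the at most `r^((2N+1)^d)` patterns cannot add up to `ε`. Hence
`α = 0` (`height_coefficient_eq_zero`), the cocycle is Gibbs, and so is the field
(`isGibbsState_of_radonNikodym`). -/

/-- The `i`-th standard basis vector of `ℤ^d`. -/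
def basisVec (i : Fin d) : Lattice d := Pi.single i 1

theorem l1dist_comm (n m : Lattice d) : l1dist n m = l1dist m n := by
  simp only [l1dist, abs_sub_comm]

theorem l1dist_add_left (k n m : Lattice d) : l1dist (k + n) (k + m) = l1dist n m := by
  simp [l1dist]

theorem l1dist_add_right (k n m : Lattice d) : l1dist (n + k) (m + k) = l1dist n m := by
  simp [l1dist]

theorem l1dist_nonneg (n m : Lattice d) : 0 ≤ l1dist n m :=
  Finset.sum_nonneg fun _ _ => abs_nonneg _

theorem l1dist_self (n : Lattice d) : l1dist n n = 0 := by simp [l1dist]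

theorem eq_of_l1dist_le_zero {n m : Lattice d} (h : l1dist n m ≤ 0) : n = m := by
  have h0 : l1dist n m = 0 := le_antisymm h (l1dist_nonneg n m)
  rw [l1dist, Finset.sum_eq_zero_iff_of_nonneg fun _ _ => abs_nonneg _] at h0
  funext i
  have := h0 i (Finset.mem_univ i)
  rw [abs_eq_zero] at this
  omega

theorem abs_sub_le_l1dist (n m : Lattice d) (i : Fin d) : |n i - m i| ≤ l1dist n m :=
  Finset.single_le_sum (f := fun i => |n i - m i|) (fun _ _ => abs_nonneg _) (Finset.mem_univ i)

theorem l1dist_zero_add_single (i : Fin d) (n : Lattice d) (k : ℤ) :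
    l1dist n (n + Pi.single i k) = |k| := by
  rw [l1dist, Finset.sum_eq_single i]
  · simp
  · intro j _ hj
    simp [Pi.single_eq_of_ne hj]
  · simp

theorem l1dist_add_basisVec (i : Fin d) (n : Lattice d) : l1dist n (n + basisVec i) = 1 := by
  simp [basisVec, l1dist_zero_add_single]

/-- The neighbours of the origin are the vectors `±e_i`. -/
theorem l1dist_zero_eq_one_iff {v : Lattice d} :
    l1dist 0 v = 1 ↔ ∃ i, v = basisVec i ∨ v = -basisVec i := by
  constructor
  · intro h
    have h1 : ∃ i, v i ≠ 0 := by
      by_contra hc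
      push Not at hc
      simp [l1dist, hc] at h
    obtain ⟨i, hi⟩ := h1
    have hsum : l1dist 0 v = |v i| + ∑ j ∈ Finset.univ.erase i, |v j| := by
      rw [l1dist, ← Finset.add_sum_erase _ _ (Finset.mem_univ i)]
      simp
    have hpos : 1 ≤ |v i| := Int.one_le_abs hi
    have hnn : 0 ≤ ∑ j ∈ Finset.univ.erase i, |v j| := Finset.sum_nonneg fun _ _ => abs_nonneg _
    have hz : ∑ j ∈ Finset.univ.erase i, |v j| = 0 := by omega
    have hvi : |v i| = 1 := by omega
    rw [Finset.sum_eq_zero_iff_of_nonneg fun _ _ => abs_nonneg _] at hz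
    have hj : ∀ j, j ≠ i → v j = 0 := fun j hj => by
      simpa using hz j (by simp [hj])
    refine ⟨i, ?_⟩
    rcases (abs_eq (by norm_num)).1 hvi with h | h
    · left
      funext j
      by_cases hji : j = i
      · subst hji; simp [basisVec, h]
      · simp [basisVec, hj j hji, Pi.single_eq_of_ne hji]
    · right
      funext j
      by_cases hji : j = i
      · subst hji; simp [basisVec, h]
      · simp [basisVec, hj j hji, Pi.single_eq_of_ne hji]
  · rintro ⟨i, rfl | rfl⟩
    · simpa using l1dist_add_basisVec i 0
    · have := l1dist_add_basisVec i (-basisVec i)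
      rw [l1dist_comm] at this
      simpa using this

theorem l1dist_eq_one_iff {n m : Lattice d} :
    l1dist n m = 1 ↔ ∃ i, m = n + basisVec i ∨ n = m + basisVec i := by
  have h : l1dist n m = l1dist 0 (m - n) := by
    have := l1dist_add_left n 0 (m - n)
    simpa using this
  rw [h, l1dist_zero_eq_one_iff]
  refine exists_congr fun i => ?_
  constructor
  · rintro (h | h)
    · left; rw [← h]; abel
    · right; rw [← neg_eq_iff_eq_neg.2 h]; abel
  · rintro (h | h)
    · left; rw [h]; abel
    · right; rw [h]; abel

theorem l1dist_add_of_unit {v : Lattice d} (hv : l1dist 0 v = 1) (n : Lattice d) :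
    l1dist n (n + v) = 1 := by
  have := l1dist_add_left n 0 v
  rw [add_zero] at this
  rw [this, hv]

theorem sum_single_eq (v : Lattice d) : v = ∑ i, v i • basisVec i := by
  funext j
  simp [basisVec, Finset.sum_apply, Pi.single_apply]

/-- A function on `ℤ^d` that is invariant under the unit translations is constant. -/
theorem eq_of_forall_add_basisVec {β : Sort*} (f : Lattice d → β)
    (hf : ∀ n i, f (n + basisVec i) = f n) (n m : Lattice d) : f n = f m := by
  let S : AddSubgroup (Lattice d) :=
    { carrier := {v | ∀ n, f (n + v) = f n}
      add_mem' := fun {a b} ha hb n => by rw [← add_assoc, hb, ha]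
      zero_mem' := fun n => by rw [add_zero]
      neg_mem' := fun {a} ha n => by
        have := ha (n + -a)
        rw [← this]; congr 1; abel }
  have hS : ∀ v, v ∈ S := fun v => by
    rw [sum_single_eq v]
    exact S.sum_mem fun i _ => S.zsmul_mem (fun n => hf n i) _
  have := hS (m - n) n
  rw [← this]; congr 1; abel

/-- Outside a box of `ℤ^d`, `d ≥ 2`, a locally constant function is constant. -/
theorem eq_of_locally_constant_off_box (hd : 2 ≤ d) {β : Sort*} (f : Lattice d → β) (R : ℤ)
    (hf : ∀ n i, (∃ j, R < |n j|) → (∃ j, R < |(n + basisVec i) j|) → f (n + basisVec i) = f n)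
    {n m : Lattice d} (hn : ∃ j, R < |n j|) (hm : ∃ j, R < |m j|) : f n = f m := by
  -- The hyperplane through `p` orthogonal to `e_j` misses the box. Pinning coordinate `j` with
  -- `Function.update` turns `f` on it into a translation-invariant function on all of `ℤ^d`.
  have key : ∀ (p q : Lattice d) (j : Fin d), R < |p j| → p j = q j → f p = f q := by
    intro p q j hp hpq
    have := eq_of_forall_add_basisVec (fun k : Lattice d => f (Function.update k j (p j))) (by
      intro k i
      by_cases hij : i = j
      · subst hij
        congr 1
        funext l
        by_cases hl : l = i
        · subst hl; simp
        · simp [Function.update_of_ne hl, basisVec, Pi.single_eq_of_ne hl]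
      · have : Function.update (k + basisVec i) j (p j) = Function.update k j (p j) + basisVec i := by
          funext l
          by_cases hl : l = j
          · subst hl; simp [basisVec, Pi.single_eq_of_ne (Ne.symm hij)]
          · simp [Function.update_of_ne hl]
        simp only [this]
        apply hf
        · exact ⟨j, by simpa using hp⟩
        · exact ⟨j, by rw [← this]; simpa using hp⟩) p q
    simp only [Function.update_eq_self] at this
    rw [this]
    congr 1
    rw [hpq, Function.update_eq_self]
  have top : ∀ p : Lattice d, (∃ j, R < |p j|) → f p = f (fun _ => R + 1) := by
    rintro p ⟨j, hj⟩
    -- A second coordinate is essential: on a line the complement of an interval has two components.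
    have : ∃ i : Fin d, i ≠ j := by
      by_cases h : j = ⟨0, by omega⟩
      · exact ⟨⟨1, by omega⟩, by rw [h]; simp⟩
      · exact ⟨⟨0, by omega⟩, fun h' => h h'.symm⟩
    obtain ⟨i, hi⟩ := this
    have h1 : f p = f (Function.update p i (R + 1)) :=
      key _ _ j hj (by rw [Function.update_of_ne hi.symm])
    rw [h1]
    exact key _ _ i (by simp only [Function.update_self]; have := le_abs_self (R + 1); omega) (by simp)
  rw [top n hn, top m hm]

end Lattice

/-! ### Height functions -/

section Heights

variable {d : ℕ}

theorem mem_Ht_iff {h : Config d ℤ} : h ∈ Ht d ↔ ∀ n i, |h (n + basisVec i) - h n| = 1 := by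
  constructor
  · intro hh n i
    rw [abs_sub_comm]
    exact hh _ _ (l1dist_add_basisVec i n)
  · intro hh n m hnm
    obtain ⟨i, rfl | rfl⟩ := l1dist_eq_one_iff.1 hnm
    · rw [abs_sub_comm]; exact hh _ _
    · exact hh _ _

theorem Ht.step {h : Config d ℤ} (hh : h ∈ Ht d) {n m : Lattice d} (hnm : l1dist n m = 1) :
    h m - h n = 1 ∨ h m - h n = -1 := by
  have := hh m n (by rw [l1dist_comm]; exact hnm)
  rcases (abs_eq (by norm_num)).1 this with h | h <;> omega

theorem Ht.lipschitz {h : Config d ℤ} (hh : h ∈ Ht d) (n m : Lattice d) :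
    |h n - h m| ≤ l1dist n m := by
  have h1 : ∀ (i : Fin d) (k : ℕ) (n : Lattice d), |h (n + (k : ℤ) • basisVec i) - h n| ≤ k := by
    intro i k
    induction k with
    | zero => intro n; simp
    | succ k ih =>
      intro n
      have e : n + ((k + 1 : ℕ) : ℤ) • basisVec i = (n + (k : ℤ) • basisVec i) + basisVec i := by
        push_cast; rw [add_smul, one_smul, add_assoc]
      rw [e]
      have a := mem_Ht_iff.1 hh (n + (k : ℤ) • basisVec i) i
      have b := ih n
      rw [abs_le] at b ⊢
      rcases (abs_eq (by norm_num)).1 a with a | a <;> push_cast <;> constructor <;> omega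
  have h2 : ∀ (i : Fin d) (k : ℤ) (n : Lattice d), |h (n + k • basisVec i) - h n| ≤ |k| := by
    intro i k n
    rcases Int.eq_nat_or_neg k with ⟨k, rfl | rfl⟩
    · simpa using h1 i k n
    · have := h1 i k (n + (-(k : ℤ)) • basisVec i)
      rw [add_assoc, ← add_smul, neg_add_cancel, zero_smul, add_zero, abs_sub_comm] at this
      simpa using this
  have h3 : ∀ (v : Lattice d) (s : Finset (Fin d)),
      |h (n + ∑ i ∈ s, v i • basisVec i) - h n| ≤ ∑ i ∈ s, |v i| := by
    intro v s
    induction s using Finset.induction_on with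
    | empty => simp
    | insert i s his ih =>
      have a := h2 i (v i) (n + ∑ i ∈ s, v i • basisVec i)
      have e : n + ∑ i ∈ insert i s, v i • basisVec i
          = (n + ∑ i ∈ s, v i • basisVec i) + v i • basisVec i := by
        rw [Finset.sum_insert his, add_assoc, add_comm (v i • basisVec i)]
      rw [e, Finset.sum_insert his]
      generalize h (n + ∑ i ∈ s, v i • basisVec i + v i • basisVec i) = p at a ⊢
      generalize h (n + ∑ i ∈ s, v i • basisVec i) = q at a ih
      exact (abs_sub_le p q _).trans (add_le_add a ih)
  have := h3 (m - n) Finset.univ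
  rw [← sum_single_eq, add_sub_cancel, abs_sub_comm] at this
  rw [l1dist_comm]
  exact this

theorem Ht.neg {h : Config d ℤ} (hh : h ∈ Ht d) : (fun n => -h n) ∈ Ht d := fun n m hnm => by
  rw [← hh n m hnm, ← abs_neg]; congr 1; ring

theorem Ht.add_const {h : Config d ℤ} (hh : h ∈ Ht d) (c : ℤ) : (fun n => h n + c) ∈ Ht d :=
  fun n m hnm => by rw [← hh n m hnm]; congr 1; ring

theorem Ht.translate {h : Config d ℤ} (hh : h ∈ Ht d) (v : Lattice d) :
    (fun n => h (n + v)) ∈ Ht d := fun n m hnm => hh _ _ (by rw [l1dist_add_right]; exact hnm)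

/-- The parity of the difference of two height functions is constant. -/
theorem Ht.parity {h g : Config d ℤ} (hh : h ∈ Ht d) (hg : g ∈ Ht d) {k : Lattice d}
    (hk : (h k - g k) % 2 = 0) (n : Lattice d) : (h n - g n) % 2 = 0 := by
  rw [← hk]
  refine eq_of_forall_add_basisVec (fun n => (h n - g n) % 2) (fun n i => ?_) n k
  rcases Ht.step hh (l1dist_add_basisVec i n) with a | a <;>
  rcases Ht.step hg (l1dist_add_basisVec i n) with b | b <;> omega

/-- Along an edge the even number `h - g` changes by 0 or `±2`, so it cannot pass from positive to
negative. One of the two functions therefore attains the maximum at both ends. -/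
theorem Ht.sup_mem {h g : Config d ℤ} (hh : h ∈ Ht d) (hg : g ∈ Ht d)
    (hp : ∀ n, (h n - g n) % 2 = 0) : (fun n => max (h n) (g n)) ∈ Ht d := by
  intro n m hnm
  have a := Ht.step hh hnm
  have b := Ht.step hg hnm
  have c := hp n
  have e := hp m
  rw [abs_eq (by norm_num)]
  simp only
  omega

theorem Ht.inf_mem {h g : Config d ℤ} (hh : h ∈ Ht d) (hg : g ∈ Ht d)
    (hp : ∀ n, (h n - g n) % 2 = 0) : (fun n => min (h n) (g n)) ∈ Ht d := by
  intro n m hnm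
  have a := Ht.step hh hnm
  have b := Ht.step hg hnm
  have c := hp n
  have e := hp m
  rw [abs_eq (by norm_num)]
  simp only
  omega

/-- The cone `n ↦ c + ‖n‖₁` is a height function. -/
theorem cone_mem_Ht (c : ℤ) : (fun n : Lattice d => c + l1dist 0 n) ∈ Ht d := by
  rw [mem_Ht_iff]
  intro n i
  have e : ∀ m : Lattice d, l1dist 0 m = |m i| + ∑ j ∈ Finset.univ.erase i, |m j| := fun m => by
    rw [l1dist, ← Finset.add_sum_erase _ _ (Finset.mem_univ i)]
    simp
  have e2 : ∑ j ∈ Finset.univ.erase i, |(n + basisVec i) j| = ∑ j ∈ Finset.univ.erase i, |n j| := by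
    refine Finset.sum_congr rfl fun j hj => ?_
    simp [basisVec, Pi.single_eq_of_ne (Finset.ne_of_mem_erase hj)]
  rw [e, e, e2]
  have e3 : (n + basisVec i) i = n i + 1 := by simp [basisVec]
  rw [e3, abs_eq (by norm_num)]
  rcases abs_cases (n i) with ⟨h1, h2⟩ | ⟨h1, h2⟩ <;>
  rcases abs_cases (n i + 1) with ⟨h3, h4⟩ | ⟨h3, h4⟩ <;> omega

theorem negCone_mem_Ht (c : ℤ) : (fun n : Lattice d => c - l1dist 0 n) ∈ Ht d := by
  have := Ht.neg (cone_mem_Ht (d := d) (-c))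
  convert this using 2
  ring

/-- Raising a local minimum by `2` gives a height function. -/
theorem Ht.flip {h : Config d ℤ} (hh : h ∈ Ht d) {n : Lattice d}
    (hn : ∀ m, l1dist n m = 1 → h m = h n + 1) : Function.update h n (h n + 2) ∈ Ht d := by
  intro p q hpq
  by_cases hp : p = n
  · subst hp
    have hq : q ≠ p := by rintro rfl; simp [l1dist_self] at hpq
    rw [Function.update_self, Function.update_of_ne hq, hn q hpq]
    simp
  · by_cases hq : q = n
    · subst hq
      rw [Function.update_self, Function.update_of_ne hp, hn p (by rw [l1dist_comm]; exact hpq)]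
      simp
    · rw [Function.update_of_ne hp, Function.update_of_ne hq]
      exact hh p q hpq

end Heights

/-! ### Reduction modulo `r` -/

section Reduction

variable {d r : ℕ}

/-- The reduction of a height function modulo `r`. -/
def red (r : ℕ) (h : Config d ℤ) : Config d (ZMod r) := fun n => (h n : ZMod r)

theorem red_mem_Xr {h : Config d ℤ} (hh : h ∈ Ht d) : red r h ∈ Xr d r := ⟨h, hh, rfl⟩

theorem exists_red_eq {x : Config d (ZMod r)} (hx : x ∈ Xr d r) : ∃ h ∈ Ht d, red r h = x := hx

theorem shift_red (n : Lattice d) (h : Config d ℤ) :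
    shift n (red r h) = red r (fun m => h (m + n)) := rfl

theorem shift_mem_Xr {x : Config d (ZMod r)} (hx : x ∈ Xr d r) (n : Lattice d) :
    shift n x ∈ Xr d r := by
  obtain ⟨h, hh, rfl⟩ := exists_red_eq hx
  rw [shift_red]
  exact red_mem_Xr (Ht.translate hh n)

/-- For `r ∉ {1, 2, 4}` small even numbers are nonzero modulo `r`. -/
theorem eq_zero_of_cast_eq_zero (hr0 : r ≠ 0) (hr1 : r ≠ 1) (hr2 : r ≠ 2) (hr4 : r ≠ 4) {k : ℤ}
    (hk : (k : ZMod r) = 0) (h4 : |k| ≤ 4) (h2 : k % 2 = 0) : k = 0 := by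
  rw [ZMod.intCast_zmod_eq_zero_iff_dvd] at hk
  by_contra hne
  obtain ⟨c, hc⟩ := hk
  have h1 : (r : ℤ) ≤ |k| := Int.le_of_dvd (abs_pos.2 hne) ((dvd_abs _ _).2 ⟨c, hc⟩)
  -- Divisibility gives `r ≤ |k| ≤ 4`, so only 3 is left, and `±3` is odd.
  have h3 : r = 3 := by omega
  subst h3
  rw [abs_le] at h4
  omega

/-- Two candidate steps differ by at most 2 in absolute value and `r > 2`, so the colours determine
the steps of any lift. -/
theorem red_step_eq_iff (hr0 : r ≠ 0) (hr1 : r ≠ 1) (hr2 : r ≠ 2) {h : Config d ℤ} (hh : h ∈ Ht d)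
    {n m : Lattice d} (hnm : l1dist n m = 1) {s : ℤ} (hs : s = 1 ∨ s = -1) :
    red r h m - red r h n = (s : ZMod r) ↔ h m - h n = s := by
  constructor
  · intro e
    have e' : ((h m - h n - s : ℤ) : ZMod r) = 0 := by
      push_cast; rw [sub_eq_zero]; exact e
    rw [ZMod.intCast_zmod_eq_zero_iff_dvd] at e'
    by_contra hne
    have h1 : (r : ℤ) ≤ |h m - h n - s| :=
      Int.le_of_dvd (abs_pos.2 (by omega)) ((dvd_abs _ _).2 e')
    have h2 : |h m - h n - s| ≤ 2 := by
      rw [abs_le]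
      rcases Ht.step hh hnm with a | a <;> omega
    omega
  · intro e
    rw [← e]
    simp [red]

theorem Xr.step {x : Config d (ZMod r)} (hx : x ∈ Xr d r) {n m : Lattice d} (hnm : l1dist n m = 1) :
    x m - x n = 1 ∨ x m - x n = -1 := by
  obtain ⟨h, hh, rfl⟩ := exists_red_eq hx
  simp only [red]
  rcases Ht.step hh hnm with a | a
  · left; rw [← Int.cast_sub, a]; simp
  · right; rw [← Int.cast_sub, a]; simp

/-- A closed `1`-form on `ℤ^d` is exact. -/
theorem exists_potential (s : Fin d → Lattice d → ℤ)
    (hs : ∀ i j n, s i n + s j (n + basisVec i) = s j n + s i (n + basisVec j)) (c : ℤ) :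
    ∃ h : Lattice d → ℤ, h 0 = c ∧ ∀ n i, h (n + basisVec i) = h n + s i n := by
  -- `T i` carries a pair (site, height) along `e_i`. Closedness of `s` says exactly that these
  -- permutations commute, so they generate an action of `ℤ^d`; the potential at `n` is the height
  -- component of the image of `(0, c)` under `n`.
  let T : Fin d → Equiv.Perm (Lattice d × ℤ) := fun i =>
    { toFun := fun p => (p.1 + basisVec i, p.2 + s i p.1)
      invFun := fun p => (p.1 - basisVec i, p.2 - s i (p.1 - basisVec i))
      left_inv := fun p => by simp
      right_inv := fun p => by simp }
  have hT : ∀ i j, Commute (T i) (T j) := by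
    intro i j
    refine Equiv.ext fun p => ?_
    simp only [Equiv.Perm.mul_apply, T, Equiv.coe_fn_mk, Prod.mk.injEq]
    constructor
    · abel
    · have := hs i j p.1
      omega
  let Φ : (Fin d → Multiplicative ℤ) →* Equiv.Perm (Lattice d × ℤ) :=
    MonoidHom.noncommPiCoprod (fun i => zpowersHom _ (T i)) (fun i j _ x y => by
      simp only [zpowersHom_apply]
      exact (hT i j).zpow_zpow _ _)
  let toM : Lattice d → (Fin d → Multiplicative ℤ) := fun n i => Multiplicative.ofAdd (n i)
  have hstep : ∀ n i, Φ (toM (n + basisVec i)) = T i * Φ (toM n) := by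
    intro n i
    have e : toM (n + basisVec i) = Pi.mulSingle i (Multiplicative.ofAdd 1) * toM n := by
      funext j
      by_cases hj : j = i
      · subst hj
        simp [toM, basisVec, ofAdd_add, mul_comm]
      · simp [toM, basisVec, Pi.single_eq_of_ne hj, Pi.mulSingle_eq_of_ne hj]
    rw [e, map_mul]
    congr 1
    refine (MonoidHom.noncommPiCoprod_mulSingle _ i _).trans ?_
    simp [zpowersHom_apply]
  have hfst : ∀ n, (Φ (toM n) (0, c)).1 = n := by
    intro n
    have := eq_of_forall_add_basisVec (fun n => (Φ (toM n) (0, c)).1 - n) (fun n i => by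
      simp only [hstep, Equiv.Perm.mul_apply]
      simp only [T, Equiv.coe_fn_mk]
      abel) n 0
    have h0 : toM 0 = 1 := rfl
    simp only [h0, map_one, Equiv.Perm.one_apply, sub_zero] at this
    exact sub_eq_zero.1 this
  refine ⟨fun n => (Φ (toM n) (0, c)).2, ?_, fun n i => ?_⟩
  · have h0 : toM 0 = 1 := rfl
    simp [h0]
  · simp only [hstep, Equiv.Perm.mul_apply]
    conv_lhs => simp only [T, Equiv.coe_fn_mk]
    rw [hfst]

/-- For `r ∉ {1, 2, 4}`, `X_r` is given by a nearest-neighbour constraint. -/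
theorem mem_Xr_of_step (hr0 : r ≠ 0) (hr1 : r ≠ 1) (hr2 : r ≠ 2) (hr4 : r ≠ 4)
    {x : Config d (ZMod r)}
    (hx : ∀ n i, x (n + basisVec i) - x n = 1 ∨ x (n + basisVec i) - x n = -1) :
    x ∈ Xr d r := by
  classical
  let s : Fin d → Lattice d → ℤ := fun i n => if x (n + basisVec i) - x n = 1 then 1 else -1
  have hs1 : ∀ i n, s i n = 1 ∨ s i n = -1 := fun i n => by
    simp only [s]; split_ifs <;> simp
  have hsx : ∀ i n, (s i n : ZMod r) = x (n + basisVec i) - x n := fun i n => by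
    simp only [s]
    split_ifs with h
    · simp [h]
    · rcases hx n i with h' | h'
      · exact absurd h' h
      · simp [h']
  -- The circulation around a unit square is a sum of four signs, hence even and at most 4 in size,
  -- and it vanishes modulo `r`.
  have hclosed : ∀ i j n, s i n + s j (n + basisVec i) = s j n + s i (n + basisVec j) := by
    intro i j n
    have h0 : ((s i n + s j (n + basisVec i) - (s j n + s i (n + basisVec j)) : ℤ) : ZMod r) = 0 := by
      push_cast
      simp only [hsx]
      rw [add_right_comm n (basisVec i) (basisVec j)]
      ring
    have a1 := hs1 i n
    have a2 := hs1 j (n + basisVec i)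
    have a3 := hs1 j n
    have a4 := hs1 i (n + basisVec j)
    have := eq_zero_of_cast_eq_zero hr0 hr1 hr2 hr4 h0 (by rw [abs_le]; omega) (by omega)
    omega
  obtain ⟨c, hc⟩ := ZMod.intCast_surjective (x 0)
  obtain ⟨h, h0, hh⟩ := exists_potential s hclosed c
  refine ⟨h, mem_Ht_iff.2 fun n i => ?_, ?_⟩
  · rw [hh, add_sub_cancel_left, abs_eq (by norm_num)]
    exact hs1 i n
  · funext n
    have := eq_of_forall_add_basisVec (fun n => (h n : ZMod r) - x n) (fun n i => by
      simp only [hh]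
      push_cast
      rw [hsx]
      ring) n 0
    simp only [h0, hc, sub_self] at this
    exact sub_eq_zero.1 this

open Classical in
/-- Points of `X_r` that agree on `∂A` can be glued along `∂A`. -/
theorem glue_mem_Xr (hr0 : r ≠ 0) (hr1 : r ≠ 1) (hr2 : r ≠ 2) (hr4 : r ≠ 4)
    {x z : Config d (ZMod r)} (hx : x ∈ Xr d r) (hz : z ∈ Xr d r) (A : Finset (Lattice d))
    (hxz : ∀ n ∈ boundary A, x n = z n) : (fun n => if n ∈ A then z n else x n) ∈ Xr d r := by
  refine mem_Xr_of_step hr0 hr1 hr2 hr4 fun n i => ?_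
  have hd1 := l1dist_add_basisVec i n
  by_cases h1 : n ∈ A
  · have e : (if n + basisVec i ∈ A then z (n + basisVec i) else x (n + basisVec i))
        = z (n + basisVec i) := by
      split_ifs with h2
      · rfl
      · exact hxz _ (mem_boundary.2 ⟨h2, n, h1, hd1⟩)
    simp only [e, h1, if_true]
    exact Xr.step hz hd1
  · by_cases h2 : n + basisVec i ∈ A
    · have := hxz n (mem_boundary.2 ⟨h1, _, h2, by rw [l1dist_comm]; exact hd1⟩)
      simp only [h1, h2, if_true, if_false, this]
      exact Xr.step hz hd1
    · simp only [h1, h2, if_false]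
      exact Xr.step hx hd1

/-- A homoclinic pair in `X_r` has height functions that agree off a finite set. -/
theorem exists_lift_pair (hd : 2 ≤ d) (hr0 : r ≠ 0) (hr1 : r ≠ 1) (hr2 : r ≠ 2)
    {x y : Config d (ZMod r)} (hxy : (x, y) ∈ homoclinic (Xr d r)) :
    ∃ h ∈ Ht d, ∃ h' ∈ Ht d, red r h = x ∧ red r h' = y ∧ {n | h n ≠ h' n}.Finite := by
  obtain ⟨hx, hy, hfin⟩ := hxy
  obtain ⟨h, hh, rfl⟩ := exists_red_eq hx
  obtain ⟨g, hg, rfl⟩ := exists_red_eq hy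
  simp only at hfin
  obtain ⟨b, hb⟩ := hfin.bddAbove
  obtain ⟨b', hb'⟩ := hfin.bddBelow
  set R : ℤ := ∑ j, (|b j| + |b' j|) with hR
  have hRj : ∀ j, |b j| + |b' j| ≤ R := fun j =>
    Finset.single_le_sum (f := fun j => |b j| + |b' j|) (fun _ _ => by positivity)
      (Finset.mem_univ j)
  have hout : ∀ n : Lattice d, (∃ j, R < |n j|) → red r h n = red r g n := by
    rintro n ⟨j, hj⟩
    by_contra hne
    have h1 : n j ≤ b j := hb hne j
    have h2 : b' j ≤ n j := hb' hne j
    have h3 := hRj j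
    have h4 := le_abs_self (b j)
    have h5 := neg_abs_le (b' j)
    have h6 := abs_nonneg (b j)
    have h7 := abs_nonneg (b' j)
    rcases abs_cases (n j) with h8 | h8 <;> omega
  -- Off the box the colours agree, so the steps of both lifts agree and `h - g` is locally constant
  -- there.
  have hloc : ∀ n m : Lattice d, (∃ j, R < |n j|) → (∃ j, R < |m j|) →
      h n - g n = h m - g m := by
    intro n m hn hm
    refine eq_of_locally_constant_off_box hd (fun n => h n - g n) R (fun n i hn hm => ?_) hn hm
    have hs := l1dist_add_basisVec i n
    have e1 : g (n + basisVec i) - g n = h (n + basisVec i) - h n := by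
      rw [← red_step_eq_iff hr0 hr1 hr2 hg hs (Ht.step hh hs), ← hout _ hn, ← hout _ hm]
      simp [red]
    omega
  let p : Lattice d := fun _ => R + 1
  have hp : ∃ j, R < |p j| := ⟨⟨0, by omega⟩, by
    have := le_abs_self (R + 1); simp only [p]; omega⟩
  -- The constant value of `h - g` off the box is a multiple of `r`, because the colours agree at
  -- `p`; adding it to `g` does not change the reduction.
  refine ⟨h, hh, fun n => g n + (h p - g p), Ht.add_const hg _, rfl, ?_, ?_⟩
  · funext n
    have := hout p hp
    simp only [red] at this ⊢
    push_cast
    rw [this]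
    ring
  · refine (Set.finite_Icc (fun _ : Fin d => -R) (fun _ => R)).subset fun n hn => ?_
    by_contra hc
    apply hn
    have : ∃ j, R < |n j| := by
      by_contra hno
      push Not at hno
      exact hc ⟨fun j => (abs_le.1 (hno j)).1, fun j => (abs_le.1 (hno j)).2⟩
    have := hloc n p this hp
    simp only
    omega

end Reduction

/-! ### Gibbs cocycles of nearest-neighbour interactions -/

section Gibbs

variable {d : ℕ} {𝒜 : Type*} {X : Set (Config d 𝒜)}

theorem pat_congr {x y : X} {W : Finset (Lattice d)}
    (h : ∀ n ∈ W, (x : Config d 𝒜) n = (y : Config d 𝒜) n) : pat x W = pat y W :=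
  Subtype.ext (funext fun n => h n.1 n.2)

/-- A set missing `A` sees no change, and a set of diameter above 1 carries no interaction; a set of
diameter at most 1 that meets `A` lies in `A ∪ ∂A`. -/
theorem gibbsCocycle_eq_sum_powerset {φ : Interaction X} (hφ : φ.IsNearestNeighbor)
    {x y : Config d 𝒜} (hxy : (x, y) ∈ homoclinic X) (A : Finset (Lattice d))
    (hA : ∀ n ∉ A, x n = y n) :
    gibbsCocycle φ ⟨(x, y), hxy⟩ = ∑ W ∈ (A ∪ boundary A).powerset,
      (φ W (pat ⟨y, hxy.2.1⟩ W) - φ W (pat ⟨x, hxy.1⟩ W)) := by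
  refine finsum_eq_sum_of_support_subset _ fun W hW => ?_
  rw [Function.mem_support] at hW
  rw [Finset.mem_coe, Finset.mem_powerset]
  have hdiam : ∀ i ∈ W, ∀ j ∈ W, l1dist i j ≤ 1 := by
    by_contra hc
    push Not at hc
    exact hW (by rw [hφ W _ hc, hφ W _ hc, sub_zero])
  have hmeet : ∃ n ∈ W, n ∈ A := by
    by_contra hc
    push Not at hc
    refine hW (sub_eq_zero.2 (congrArg _ (pat_congr fun n hn => (hA n (hc n hn)).symm)))
  obtain ⟨n, hnW, hnA⟩ := hmeet
  intro m hm
  rw [Finset.mem_union]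
  by_cases hmA : m ∈ A
  · exact Or.inl hmA
  · refine Or.inr (mem_boundary.2 ⟨hmA, n, hnA, ?_⟩)
    by_contra hne
    have h1 := hdiam n hnW m hm
    have := eq_of_l1dist_le_zero (n := n) (m := m) (by omega)
    exact hmA (this ▸ hnA)

theorem gibbsCocycle_trans {φ : Interaction X} (hφ : φ.IsNearestNeighbor) {x y z : Config d 𝒜}
    (hxy : (x, y) ∈ homoclinic X) (hyz : (y, z) ∈ homoclinic X) (hxz : (x, z) ∈ homoclinic X) :
    gibbsCocycle φ ⟨(x, z), hxz⟩ = gibbsCocycle φ ⟨(x, y), hxy⟩ + gibbsCocycle φ ⟨(y, z), hyz⟩ := by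
  classical
  let A := hxy.2.2.toFinset ∪ hyz.2.2.toFinset
  have h1 : ∀ n ∉ A, x n = y n := fun n hn => by
    by_contra hc; exact hn (by simp [A]; exact Or.inl hc)
  have h2 : ∀ n ∉ A, y n = z n := fun n hn => by
    by_contra hc; exact hn (by simp [A]; exact Or.inr hc)
  rw [gibbsCocycle_eq_sum_powerset hφ hxy A h1, gibbsCocycle_eq_sum_powerset hφ hyz A h2,
    gibbsCocycle_eq_sum_powerset hφ hxz A fun n hn => (h1 n hn).trans (h2 n hn),
    ← Finset.sum_add_distrib]
  exact Finset.sum_congr rfl fun W _ => by ring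

end Gibbs

/-! ### Edge interactions -/

section Edge

variable {d r : ℕ}

open Classical in
/-- The interaction that is `E (a, b)` on the patterns `(a, b)` on edges `{k, k + e_i}` and vanishes
on all other patterns. -/
noncomputable def edgeInteraction (i : Fin d) (E : ZMod r → ZMod r → ℝ) : Interaction (Xr d r) :=
  fun W w =>
    let x : Lattice d → ZMod r := fun n => if hn : n ∈ W then w.1 ⟨n, hn⟩ else 0
    ∑ k ∈ W, if W = {k, k + basisVec i} then E (x k) (x (k + basisVec i)) else 0

variable (i : Fin d) (E : ZMod r → ZMod r → ℝ)

open Classical in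
theorem edgeInteraction_pat (x : Xr d r) (W : Finset (Lattice d)) :
    edgeInteraction i E W (pat x W) = ∑ k ∈ W,
      if W = {k, k + basisVec i} then E (x.1 k) (x.1 (k + basisVec i)) else 0 := by
  refine Finset.sum_congr rfl fun k hk => ?_
  split_ifs with h
  · have h2 : k + basisVec i ∈ W := by rw [h]; simp
    simp [hk, h2, pat]
  · rfl

theorem basisVec_ne_zero : basisVec i ≠ (0 : Lattice d) := fun h => by
  have := congrFun h i
  simp [basisVec] at this

theorem edge_injective : Function.Injective fun k : Lattice d => ({k, k + basisVec i} : Finset _) := by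
  intro k l hkl
  simp only at hkl
  have h1 : k ∈ ({l, l + basisVec i} : Finset (Lattice d)) := hkl ▸ by simp
  have h2 : l ∈ ({k, k + basisVec i} : Finset (Lattice d)) := hkl ▸ by simp
  simp only [Finset.mem_insert, Finset.mem_singleton] at h1 h2
  rcases h1 with h1 | h1
  · exact h1
  · rcases h2 with h2 | h2
    · exact h2.symm
    · exfalso
      have := congrFun h1 i
      have h' := congrFun h2 i
      simp [basisVec] at this h'
      omega

theorem edgeInteraction_edge (x : Xr d r) (k : Lattice d) :
    edgeInteraction i E {k, k + basisVec i} (pat x _) = E (x.1 k) (x.1 (k + basisVec i)) := by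
  classical
  rw [edgeInteraction_pat, Finset.sum_eq_single k]
  · simp
  · intro l _ hl
    rw [if_neg]
    intro h
    exact hl (edge_injective i h).symm
  · simp

theorem edgeInteraction_of_ne {W : Finset (Lattice d)} (w : language (Xr d r) W)
    (hW : ∀ k, W ≠ {k, k + basisVec i}) : edgeInteraction i E W w = 0 :=
  Finset.sum_eq_zero fun k _ => by rw [if_neg (hW k)]

theorem edgeInteraction_isNearestNeighbor : (edgeInteraction i E).IsNearestNeighbor := by
  rintro W w ⟨p, hp, q, hq, hpq⟩
  refine edgeInteraction_of_ne i E w fun k hk => ?_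
  subst hk
  have h1 := l1dist_add_basisVec i k
  have h2 := l1dist_comm k (k + basisVec i)
  have h3 := l1dist_self k
  have h4 := l1dist_self (k + basisVec i)
  simp only [Finset.mem_insert, Finset.mem_singleton] at hp hq
  rcases hp with rfl | rfl <;> rcases hq with rfl | rfl <;> omega

theorem edgeInteraction_isShiftInvariant : (edgeInteraction i E).IsShiftInvariant := by
  classical
  intro n W x y hyx
  by_cases hW : ∃ k, W = {k, k + basisVec i}
  · obtain ⟨k, rfl⟩ := hW
    have e : (({k, k + basisVec i} : Finset (Lattice d)).image fun m => m - n)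
        = {k - n, k - n + basisVec i} := by
      rw [Finset.image_insert, Finset.image_singleton, sub_add_eq_add_sub]
    rw [e, edgeInteraction_edge, edgeInteraction_edge, hyx]
    simp [shift, sub_add_eq_add_sub]
  · push Not at hW
    rw [edgeInteraction_of_ne i E _ hW, edgeInteraction_of_ne i E]
    intro k hk
    apply hW (k + n)
    have : (W.image fun m => m - n).image (fun m => m + n) = W := by
      rw [Finset.image_image]; simp [Function.comp_def]
    rw [← this, hk, Finset.image_insert, Finset.image_singleton, add_right_comm]

/-- The cocycle of an edge interaction is the sum of the changes at the edges. -/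
theorem gibbsCocycle_edgeInteraction {x y : Config d (ZMod r)} (hxy : (x, y) ∈ homoclinic (Xr d r))
    (K : Finset (Lattice d)) (hK : ∀ k, x k ≠ y k → k ∈ K ∧ k - basisVec i ∈ K) :
    gibbsCocycle (edgeInteraction i E) ⟨(x, y), hxy⟩ =
      ∑ k ∈ K, (E (y k) (y (k + basisVec i)) - E (x k) (x (k + basisVec i))) := by
  classical
  have h1 : gibbsCocycle (edgeInteraction i E) ⟨(x, y), hxy⟩ =
      ∑ W ∈ K.image (fun k => ({k, k + basisVec i} : Finset (Lattice d))),
        (edgeInteraction i E W (pat ⟨y, hxy.2.1⟩ W) - edgeInteraction i E W (pat ⟨x, hxy.1⟩ W)) := by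
    refine finsum_eq_sum_of_support_subset _ fun W hW => ?_
    rw [Function.mem_support] at hW
    have : ∃ k, W = {k, k + basisVec i} := by
      by_contra hc
      push Not at hc
      exact hW (by rw [edgeInteraction_of_ne i E _ hc, edgeInteraction_of_ne i E _ hc, sub_zero])
    obtain ⟨k, rfl⟩ := this
    rw [Finset.mem_coe, Finset.mem_image]
    refine ⟨k, ?_, rfl⟩
    by_contra hk
    apply hW
    have e1 : x k = y k := by
      by_contra hc
      exact hk (hK k hc).1
    have e2 : x (k + basisVec i) = y (k + basisVec i) := by
      by_contra hc
      have := (hK _ hc).2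
      rw [add_sub_cancel_right] at this
      exact hk this
    rw [edgeInteraction_edge, edgeInteraction_edge]
    simp [e1, e2]
  rw [h1, Finset.sum_image fun k _ l _ h => edge_injective i h]
  refine Finset.sum_congr rfl fun k _ => ?_
  rw [edgeInteraction_edge, edgeInteraction_edge]

/-- A weight on the edges of the cycle `ℤ/r`, as a symmetric function of the ordered edges. -/
def cycleWeight (e : ZMod r → ℝ) (a b : ZMod r) : ℝ := if b = a + 1 then e a else e b

theorem cycleWeight_succ (e : ZMod r → ℝ) (a : ZMod r) : cycleWeight e a (a + 1) = e a := by
  simp [cycleWeight]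

theorem two_ne_zero_zmod (hr0 : r ≠ 0) (hr1 : r ≠ 1) (hr2 : r ≠ 2) : (2 : ZMod r) ≠ 0 := by
  intro h
  have h' : ((2 : ℕ) : ZMod r) = 0 := by exact_mod_cast h
  rw [ZMod.natCast_eq_zero_iff] at h'
  have := Nat.le_of_dvd (by norm_num) h'
  omega

/-- For `r = 2` the pairs `(a, a + 1)` and `(a + 1, a)` would both be ascending; `2 ≠ 0` makes the
orientation of an edge unambiguous. -/
theorem cycleWeight_succ_left (hr0 : r ≠ 0) (hr1 : r ≠ 1) (hr2 : r ≠ 2) (e : ZMod r → ℝ)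
    (a : ZMod r) : cycleWeight e (a + 1) a = e a := by
  rw [cycleWeight, if_neg]
  intro h
  apply two_ne_zero_zmod hr0 hr1 hr2
  linear_combination -h

theorem homoclinic_red {h h' : Config d ℤ} (hh : h ∈ Ht d) (hh' : h' ∈ Ht d)
    (hfin : {n | h n ≠ h' n}.Finite) : (red r h, red r h') ∈ homoclinic (Xr d r) :=
  ⟨red_mem_Xr hh, red_mem_Xr hh', hfin.subset fun n hn hc => hn (by simp only [red, hc])⟩

theorem finite_ne_update {β : Type*} (h : Lattice d → β) (n : Lattice d) (c : β) :
    {m | h m ≠ Function.update h n c m}.Finite :=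
  (Set.finite_singleton n).subset fun m hm => by
    by_contra hc
    exact hm (by rw [Function.update_of_ne hc])

/-- Exactly two edges in direction `i` contain `n`, and raising a local minimum of colour `a` moves
the colours of both from `{a, a + 1}` to `{a + 1, a + 2}`. This is why a coboundary of `e` can be
realised by an interaction. -/
theorem gibbsCocycle_flip (hr0 : r ≠ 0) (hr1 : r ≠ 1) (hr2 : r ≠ 2) (e : ZMod r → ℝ)
    {h : Config d ℤ} {n : Lattice d} (hn : ∀ m, l1dist n m = 1 → h m = h n + 1)
    (hxy : (red r h, red r (Function.update h n (h n + 2))) ∈ homoclinic (Xr d r)) :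
    gibbsCocycle (edgeInteraction i (cycleWeight e)) ⟨_, hxy⟩
      = 2 * (e ((h n : ℤ) + 1) - e (h n : ℤ)) := by
  classical
  have hne : n ≠ n - basisVec i := fun h => basisVec_ne_zero i (sub_eq_self.1 h.symm)
  have hne' : n + basisVec i ≠ n := fun h => basisVec_ne_zero i (by simpa using h)
  rw [gibbsCocycle_edgeInteraction i _ hxy {n, n - basisVec i}, Finset.sum_pair hne]
  · have e1 := hn (n + basisVec i) (l1dist_add_basisVec i n)
    have e2 := hn (n - basisVec i) (by
      rw [l1dist_comm]; simpa using l1dist_add_basisVec i (n - basisVec i))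
    simp only [red, sub_add_cancel, Function.update_self, Function.update_of_ne hne',
      Function.update_of_ne hne.symm, e1, e2]
    push_cast
    have e3 : (h n : ZMod r) + 2 = (h n : ZMod r) + 1 + 1 := by ring
    rw [e3, cycleWeight_succ, cycleWeight_succ, cycleWeight_succ_left hr0 hr1 hr2,
      cycleWeight_succ_left hr0 hr1 hr2]
    ring
  · intro k hk
    have : k = n := by
      by_contra hc
      exact hk (by simp only [red, Function.update_of_ne hc])
    simp [this]

end Edge

/-! ### The structure of shift-invariant Markov cocycles on `X_r` -/

section Structure

variable {d r : ℕ}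

theorem exists_eq_of_finite_ne [Nonempty (Fin d)] {h h' : Config d ℤ}
    (hfin : {n | h n ≠ h' n}.Finite) :
    ∃ n, h n = h' n := by
  by_contra hc
  push Not at hc
  have : {n | h n ≠ h' n} = Set.univ := Set.eq_univ_of_forall hc
  rw [this] at hfin
  exact Set.infinite_univ hfin

theorem Ht.parity_of_finite_ne [Nonempty (Fin d)] {h h' : Config d ℤ} (hh : h ∈ Ht d)
    (hh' : h' ∈ Ht d) (hfin : {n | h n ≠ h' n}.Finite) (n : Lattice d) : (h n - h' n) % 2 = 0 := by
  obtain ⟨k, hk⟩ := exists_eq_of_finite_ne hfin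
  exact Ht.parity hh hh' (k := k) (by rw [hk]; simp) n

/-- A height function `h ≤ h'` that differs from `h'` at finitely many sites can be transformed
into `h'` by successively raising local minima. -/
theorem flip_induction [Nonempty (Fin d)] {h' : Config d ℤ} (hh' : h' ∈ Ht d)
    {Q : Config d ℤ → Prop} (refl : Q h')
    (step : ∀ h ∈ Ht d, {n | h n ≠ h' n}.Finite → (∀ n, h n ≤ h' n) → ∀ n, h n < h' n →
      (∀ m, l1dist n m = 1 → h m = h n + 1) → Q (Function.update h n (h n + 2)) → Q h)
    {h : Config d ℤ} (hh : h ∈ Ht d) (hfin : {n | h n ≠ h' n}.Finite) (hle : ∀ n, h n ≤ h' n) :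
    Q h := by
  obtain ⟨F, hF⟩ : ∃ F : Finset (Lattice d), ∀ n ∉ F, h n = h' n :=
    ⟨hfin.toFinset, fun n hn => by simpa using hn⟩
  obtain ⟨k, hk⟩ : ∃ k, ∑ n ∈ F, (h' n - h n).toNat = k := ⟨_, rfl⟩
  induction k using Nat.strong_induction_on generalizing h with
  | _ k ih =>
    by_cases heq : ∃ n, h n ≠ h' n
    · obtain ⟨n₀, hn₀⟩ := heq
      -- A lowest site of disagreement is a local minimum of `h`.
      obtain ⟨n, hn, hmin⟩ := Set.exists_min_image _ h hfin ⟨n₀, hn₀⟩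
      have hlt : h n < h' n := lt_of_le_of_ne (hle n) hn
      have hpar := Ht.parity_of_finite_ne hh hh' hfin n
      have hloc : ∀ m, l1dist n m = 1 → h m = h n + 1 := by
        intro m hm
        rcases Ht.step hh hm with a | a
        · omega
        -- By minimality a lower neighbour would be a site of agreement, while parity forces `h' n ≥
        -- h n + 2`; then `h'` would jump by at least 3.
        · exfalso
          have : h m = h' m := by
            by_contra hc
            have := hmin m hc
            omega
          rcases Ht.step hh' hm with b | b <;> omega
      have hle' : ∀ m, Function.update h n (h n + 2) m ≤ h' m := by
        intro m
        by_cases hm : m = n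
        · subst hm; rw [Function.update_self]; omega
        · rw [Function.update_of_ne hm]; exact hle m
      have hnF : n ∈ F := by
        by_contra hc
        exact hn (hF n hc)
      refine step h hh hfin hle n hlt hloc (ih _ ?_ (Ht.flip hh hloc) ?_ hle' ?_ rfl)
      · rw [← hk]
        refine Finset.sum_lt_sum (fun m _ => ?_) ⟨n, hnF, ?_⟩
        · by_cases hm : m = n
          · subst hm; rw [Function.update_self]; omega
          · rw [Function.update_of_ne hm]
        · rw [Function.update_self]; omega
      · refine (hfin.union (Set.finite_singleton n)).subset fun m hm => ?_
        by_cases hmn : m = n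
        · exact Or.inr hmn
        · left
          simp only [Set.mem_ofPred_eq, Function.update_of_ne hmn] at hm
          exact hm
      · intro m hm
        have hmn : m ≠ n := fun h => hm (h ▸ hnF)
        rw [Function.update_of_ne hmn]
        exact hF m hm
    · push Not at heq
      have : h = h' := funext heq
      rw [this]; exact refl

/-- The value of a shift-invariant Markov cocycle at a flip depends on the colour only. -/
theorem exists_flip_value {M : homoclinic (Xr d r) → ℝ} (hM : IsShiftInvariantMarkovCocycle M) :
    ∃ m : ZMod r → ℝ, ∀ h ∈ Ht d, ∀ n, (∀ k, l1dist n k = 1 → h k = h n + 1) →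
      ∀ hxy : (red r h, red r (Function.update h n (h n + 2))) ∈ homoclinic (Xr d r),
        M ⟨_, hxy⟩ = m (h n : ℤ) := by
  classical
  have hcone : ∀ c : ℤ, ∀ k : Lattice d, l1dist 0 k = 1 →
      (fun n : Lattice d => c + l1dist 0 n) k = (fun n : Lattice d => c + l1dist 0 n) 0 + 1 := by
    intro c k hk
    simp [hk, l1dist_self]
  have hhom : ∀ c : ℤ, (red r (fun n : Lattice d => c + l1dist 0 n),
      red r (Function.update (fun n : Lattice d => c + l1dist 0 n) 0
        ((fun n : Lattice d => c + l1dist 0 n) 0 + 2))) ∈ homoclinic (Xr d r) := fun c =>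
    homoclinic_red (cone_mem_Ht c) (Ht.flip (cone_mem_Ht c) (hcone c)) (finite_ne_update _ _ _)
  choose lift hlift using ZMod.intCast_surjective (n := r)
  -- The model flip is at the tip of a cone whose tip has colour `a`. After shifting `n` to the
  -- origin, every flip of that colour looks the same on `{0} ∪ ∂{0}`, so the Markov property
  -- identifies the values.
  refine ⟨fun a => M ⟨_, hhom (lift a)⟩, fun h hh n hn hxy => ?_⟩
  have hs : (shift n (red r h), shift n (red r (Function.update h n (h n + 2)))) ∈
      homoclinic (Xr d r) := by
    refine ⟨shift_mem_Xr hxy.1 n, shift_mem_Xr hxy.2.1 n, (Set.finite_singleton 0).subset ?_⟩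
    intro m hm
    by_contra hc
    apply hm
    have : m + n ≠ n := fun h => hc (by simpa using h)
    simp [shift, red, Function.update_of_ne this]
  rw [← hM.invariant n _ _ hxy hs]
  have hl := hlift (h n : ZMod r)
  refine hM.markov {0} _ _ _ _ hs (hhom _) ?_ ?_ ?_ ?_
  · intro m hm
    have : m + n ≠ n := fun h => hm (by simpa using h)
    simp [shift, red, Function.update_of_ne this]
  · intro m hm
    have : m ≠ 0 := fun h => hm (by simpa using h)
    simp [red, Function.update_of_ne this]
  · intro m hm
    rw [Finset.mem_union, mem_boundary, Finset.mem_singleton] at hm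
    rcases hm with rfl | ⟨_, k, hk, hm⟩
    · simp [shift, red, l1dist_self, hl]
    · rw [Finset.mem_singleton] at hk
      subst hk
      have : l1dist n (m + n) = 1 := by
        rw [← hm, ← l1dist_add_right n 0 m, zero_add]
      simp [shift, red, hm, hn _ this, hl]
  · intro m hm
    rw [Finset.mem_union, mem_boundary, Finset.mem_singleton] at hm
    rcases hm with rfl | ⟨_, k, hk, hm⟩
    · simp [shift, red, l1dist_self, hl]
    · rw [Finset.mem_singleton] at hk
      subst hk
      have h1 : l1dist n (m + n) = 1 := by
        rw [← hm, ← l1dist_add_right n 0 m, zero_add]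
      have h2 : m ≠ 0 := fun h => by subst h; simp [l1dist_self] at hm
      have h3 : m + n ≠ n := fun h => h2 (by simpa using h)
      simp [shift, red, hm, hn _ h1, hl, Function.update_of_ne h2, Function.update_of_ne h3]

/-- A function on `ℤ/r` of mean zero is a coboundary. -/
theorem exists_coboundary [NeZero r] (f : ZMod r → ℝ) (hf : ∑ a, f a = 0) :
    ∃ e : ZMod r → ℝ, ∀ a, e (a + 1) - e a = f a := by
  have hsum : ∑ j ∈ Finset.range r, f (j : ZMod r) = 0 := by
    rw [← hf]
    refine Finset.sum_bij (fun j _ => (j : ZMod r)) (fun _ _ => Finset.mem_univ _) ?_ ?_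
      (fun _ _ => rfl)
    · intro a ha b hb hab
      have := congrArg ZMod.val hab
      rwa [ZMod.val_natCast_of_lt (Finset.mem_range.1 ha),
        ZMod.val_natCast_of_lt (Finset.mem_range.1 hb)] at this
    · intro b _
      exact ⟨b.val, Finset.mem_range.2 (ZMod.val_lt b), ZMod.natCast_zmod_val b⟩
  have hper : ∀ k : ℕ, k < r → ∀ e' : ZMod r → ℝ,
      (∀ j < r, e' (j : ZMod r) = ∑ l ∈ Finset.range j, f (l : ZMod r)) →
      e' ((k : ZMod r) + 1) - e' (k : ZMod r) = f (k : ZMod r) := by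
    intro k hk e' he'
    rw [he' k hk]
    by_cases hk1 : k + 1 < r
    · have : ((k : ZMod r) + 1) = ((k + 1 : ℕ) : ZMod r) := by push_cast; rfl
      rw [this, he' _ hk1, Finset.sum_range_succ]; ring
    -- The potential is given by partial sums along `0, …, r - 1`; mean zero is needed precisely at
    -- the step from `r - 1` back to 0.
    · have hkr : k + 1 = r := by omega
      have : ((k : ZMod r) + 1) = ((0 : ℕ) : ZMod r) := by
        have : ((k + 1 : ℕ) : ZMod r) = 0 := by rw [hkr]; simp
        push_cast at this; simpa using this
      rw [this, he' 0 (Nat.pos_of_ne_zero (NeZero.ne r))]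
      have hR : Finset.range r = Finset.range (k + 1) := by rw [hkr]
      rw [hR, Finset.sum_range_succ] at hsum
      simp only [Finset.range_zero, Finset.sum_empty]
      linarith
  refine ⟨fun a => ∑ l ∈ Finset.range a.val, f (l : ZMod r), fun a => ?_⟩
  have := hper a.val (ZMod.val_lt a) (fun a => ∑ l ∈ Finset.range a.val, f (l : ZMod r))
    (fun j hj => by simp only [ZMod.val_natCast_of_lt hj])
  simpa only [ZMod.natCast_zmod_val] using this

/-- Every shift-invariant Markov cocycle on `X_r` is the sum of a multiple of the total change of
height and the cocycle of a shift-invariant nearest-neighbour interaction. -/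
theorem markovCocycle_structure [NeZero r] (hr1 : r ≠ 1) (hr2 : r ≠ 2) (i : Fin d)
    {M : homoclinic (Xr d r) → ℝ} (hM : IsShiftInvariantMarkovCocycle M) :
    ∃ (α : ℝ) (e : ZMod r → ℝ), ∀ h ∈ Ht d, ∀ h' ∈ Ht d, ∀ F : Finset (Lattice d),
      (∀ n ∉ F, h n = h' n) → ∀ hxy : (red r h, red r h') ∈ homoclinic (Xr d r),
        M ⟨_, hxy⟩ = α * ∑ n ∈ F, ((h' n : ℝ) - h n) +
          gibbsCocycle (edgeInteraction i (cycleWeight e)) ⟨_, hxy⟩ := by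
  classical
  have hr0 : r ≠ 0 := NeZero.ne r
  have : Nonempty (Fin d) := ⟨i⟩
  obtain ⟨m, hm⟩ := exists_flip_value hM
  -- A flip adds 2 to the height and the edge interaction contributes `2 (e (a + 1) - e a)`, so one
  -- needs `m a / 2 = α + e (a + 1) - e a`. Summing over the `r` colours forces this `α`.
  set α : ℝ := (∑ a, m a) / (2 * r) with hα
  obtain ⟨e, he⟩ := exists_coboundary (fun a => m a / 2 - α) (by
    rw [Finset.sum_sub_distrib, ← Finset.sum_div, Finset.sum_const, Finset.card_univ, ZMod.card, hα,
      nsmul_eq_mul]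
    have : (r : ℝ) ≠ 0 := by exact_mod_cast hr0
    field_simp
    ring)
  refine ⟨α, e, ?_⟩
  set φ := edgeInteraction i (cycleWeight e) with hφ
  have hnn : φ.IsNearestNeighbor := edgeInteraction_isNearestNeighbor i _
  have mono : ∀ h' ∈ Ht d, ∀ h ∈ Ht d, ∀ F : Finset (Lattice d), (∀ n ∉ F, h n = h' n) →
      (∀ n, h n ≤ h' n) → ∀ hxy : (red r h, red r h') ∈ homoclinic (Xr d r),
        M ⟨_, hxy⟩ = α * ∑ n ∈ F, ((h' n : ℝ) - h n) + gibbsCocycle φ ⟨_, hxy⟩ := by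
    intro h' hh' h hh F hF hle
    have hfin : {n | h n ≠ h' n}.Finite := F.finite_toSet.subset fun n hn => by
      by_contra hc; exact hn (hF n hc)
    refine flip_induction hh' (Q := fun h => (∀ n ∉ F, h n = h' n) →
      ∀ hxy : (red r h, red r h') ∈ homoclinic (Xr d r),
        M ⟨_, hxy⟩ = α * ∑ n ∈ F, ((h' n : ℝ) - h n) + gibbsCocycle φ ⟨_, hxy⟩)
      ?_ ?_ hh hfin hle hF
    · intro _ hxy
      have h1 := hM.cocycle _ _ _ hxy hxy hxy
      have h2 := gibbsCocycle_trans hnn hxy hxy hxy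
      simp only [sub_self, Finset.sum_const_zero, mul_zero, zero_add]
      linarith
    · intro h hh hfin hle n hlt hloc ih hF hxy
      have hnF : n ∈ F := by
        by_contra hc
        have := hF n hc
        omega
      have hu := Ht.flip hh hloc
      have h1 : (red r h, red r (Function.update h n (h n + 2))) ∈ homoclinic (Xr d r) :=
        homoclinic_red hh hu (finite_ne_update _ _ _)
      have hF' : ∀ k ∉ F, Function.update h n (h n + 2) k = h' k := by
        intro k hk
        have : k ≠ n := fun h => hk (h ▸ hnF)
        rw [Function.update_of_ne this]; exact hF k hk
      have h2 : (red r (Function.update h n (h n + 2)), red r h') ∈ homoclinic (Xr d r) :=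
        homoclinic_red hu hh' (F.finite_toSet.subset fun n hn => by
          by_contra hc; exact hn (hF' n hc))
      have e1 := ih hF' h2
      have e2 := hm h hh n hloc h1
      have e3 := gibbsCocycle_flip i hr0 hr1 hr2 e hloc h1
      have e4 := hM.cocycle _ _ _ h1 h2 hxy
      have e5 := gibbsCocycle_trans hnn h1 h2 hxy
      have e6 := he (h n : ZMod r)
      have e7 : ∑ k ∈ F, ((h' k : ℝ) - h k)
          = ∑ k ∈ F, ((h' k : ℝ) - (Function.update h n (h n + 2) k : ℤ)) + 2 := by
        rw [← Finset.add_sum_erase _ _ hnF,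
          ← Finset.add_sum_erase _ (fun k => (h' k : ℝ) - (Function.update h n (h n + 2) k : ℤ)) hnF]
        have : ∀ k ∈ F.erase n, (h' k : ℝ) - (Function.update h n (h n + 2) k : ℤ)
            = h' k - h k := fun k hk => by rw [Function.update_of_ne (Finset.ne_of_mem_erase hk)]
        rw [Finset.sum_congr rfl this]
        simp only [Function.update_self]
        push_cast
        ring
      rw [e4, e5, e7, e1, e2, hφ, e3]
      linarith
  intro h hh h' hh' F hF hxy
  have hfin : {n | h n ≠ h' n}.Finite := F.finite_toSet.subset fun n hn => by
    by_contra hc; exact hn (hF n hc)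
  -- Arbitrary pairs need not be comparable, but both lie below their maximum, and the cocycle
  -- equation subtracts the two ascents.
  set g : Config d ℤ := fun n => max (h n) (h' n) with hg
  have hgH : g ∈ Ht d := Ht.sup_mem hh hh' (Ht.parity_of_finite_ne hh hh' hfin)
  have hF1 : ∀ n ∉ F, h n = g n := fun n hn => by simp [hg, hF n hn]
  have hF2 : ∀ n ∉ F, h' n = g n := fun n hn => by simp [hg, hF n hn]
  have fin1 : {n | h n ≠ g n}.Finite := F.finite_toSet.subset fun n hn => by
    by_contra hc; exact hn (hF1 n hc)
  have fin2 : {n | h' n ≠ g n}.Finite := F.finite_toSet.subset fun n hn => by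
    by_contra hc; exact hn (hF2 n hc)
  have h1 := homoclinic_red (r := r) hh hgH fin1
  have h2 := homoclinic_red (r := r) hh' hgH fin2
  have e1 := mono g hgH h hh F hF1 (fun n => le_max_left _ _) h1
  have e2 := mono g hgH h' hh' F hF2 (fun n => le_max_right _ _) h2
  have e3 := hM.cocycle _ _ _ hxy h2 h1
  have e4 := gibbsCocycle_trans hnn hxy h2 h1
  have e5 : ∑ n ∈ F, ((h' n : ℝ) - h n) = ∑ n ∈ F, ((g n : ℝ) - h n) - ∑ n ∈ F, ((g n : ℝ) - h' n) := by
    rw [← Finset.sum_sub_distrib]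
    exact Finset.sum_congr rfl fun n _ => by ring
  rw [e5, mul_sub]
  linarith

end Structure

/-! ### Cylinders and supports -/

section Cylinders

variable {d r : ℕ}

theorem mem_cyl_restrict {𝒜 : Type*} {W : Finset (Lattice d)} {x z : Config d 𝒜} :
    z ∈ cyl W (W.restrict x) ↔ ∀ n ∈ W, z n = x n := by
  simp only [cyl, funext_iff]
  exact ⟨fun h n hn => h ⟨n, hn⟩, fun h n => h n.1 n.2⟩

theorem mem_cyl {𝒜 : Type*} {W : Finset (Lattice d)} {a : W → 𝒜} {z : Config d 𝒜} :
    z ∈ cyl W a ↔ W.restrict z = a := Iff.rfl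

theorem cyl_restrict_congr {𝒜 : Type*} {W : Finset (Lattice d)} {x y : Config d 𝒜}
    (h : ∀ n ∈ W, x n = y n) : W.restrict x = W.restrict y := funext fun n => h n.1 n.2

theorem cyl_union {𝒜 : Type*} (A B : Finset (Lattice d)) (x : Config d 𝒜) :
    cyl (A ∪ B) ((A ∪ B).restrict x) = cyl A (A.restrict x) ∩ cyl B (B.restrict x) := by
  ext z
  simp only [Set.mem_inter_iff, mem_cyl_restrict, Finset.mem_union]
  exact ⟨fun h => ⟨fun n hn => h n (Or.inl hn), fun n hn => h n (Or.inr hn)⟩,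
    fun h n hn => hn.elim (h.1 n) (h.2 n)⟩

theorem measurableSet_cyl (W : Finset (Lattice d)) (a : W → ZMod r) :
    MeasurableSet (cyl W a) := by
  have : cyl W a = ⋂ n : W, (fun z : Config d (ZMod r) => z n.1) ⁻¹' {a n} := by
    ext z
    simp [cyl, funext_iff]
  rw [this]
  exact MeasurableSet.iInter fun n => measurable_pi_apply _ (measurableSet_singleton _)

theorem isOpen_cyl (W : Finset (Lattice d)) (a : W → ZMod r) : IsOpen (cyl W a) := by
  have : cyl W a = ⋂ n : W, (fun z : Config d (ZMod r) => z n.1) ⁻¹' {a n} := by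
    ext z
    simp [cyl, funext_iff]
  rw [this]
  exact isOpen_iInter_of_finite fun n => (isOpen_discrete _).preimage (continuous_apply _)

variable {μ : Measure (Config d (ZMod r))}

theorem cyl_real_pos [IsFiniteMeasure μ] {x : Config d (ZMod r)} (hx : x ∈ μ.support)
    (W : Finset (Lattice d)) : 0 < μ.real (cyl W (W.restrict x)) := by
  have := (Measure.mem_support_iff_forall x).1 hx (cyl W (W.restrict x))
    ((isOpen_cyl W _).mem_nhds rfl)
  exact ENNReal.toReal_pos this.ne' (measure_ne_top _ _)

theorem mem_of_isClosed_of_forall_exists {S : Set (Config d (ZMod r))} (hS : IsClosed S)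
    {x : Config d (ZMod r)} (h : ∀ W : Finset (Lattice d), ∃ z ∈ S, ∀ n ∈ W, z n = x n) :
    x ∈ S := by
  rw [← hS.closure_eq, mem_closure_iff]
  intro U hU hxU
  obtain ⟨I, u, hu, hIU⟩ := isOpen_pi_iff.1 hU x hxU
  obtain ⟨z, hz, hzx⟩ := h I
  exact ⟨z, hIU fun n hn => by rw [hzx n hn]; exact (hu n hn).2, hz⟩

theorem shift_mem_support [NeZero r] (hinv : ShiftInvariant μ) {x : Config d (ZMod r)}
    (hx : x ∈ μ.support) (n : Lattice d) : shift n x ∈ μ.support := by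
  rw [Measure.mem_support_iff_forall] at hx ⊢
  intro U hU
  obtain ⟨V, hVU, hV, hxV⟩ := mem_nhds_iff.1 hU
  have hc : Continuous (shift n : Config d (ZMod r) → _) :=
    continuous_pi fun m => continuous_apply _
  calc 0 < μ (shift n ⁻¹' V) := hx _ ((hV.preimage hc).mem_nhds hxV)
    _ = μ V := (hinv n).measure_preimage hV.measurableSet.nullMeasurableSet
    _ ≤ μ U := measure_mono hVU

end Cylinders

/-! ### The Radon–Nikodym cocycle of a Markov random field -/

section RadonNikodym

variable {d r : ℕ} {μ : Measure (Config d (ZMod r))}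

theorem cond_real_cyl (x : Config d (ZMod r)) (A B : Finset (Lattice d)) :
    (ProbabilityTheory.cond μ (cyl B (B.restrict x))).real (cyl A (A.restrict x)) =
      μ.real (cyl (A ∪ B) ((A ∪ B).restrict x)) / μ.real (cyl B (B.restrict x)) := by
  rw [measureReal_def, ProbabilityTheory.cond_apply (measurableSet_cyl _ _), cyl_union,
    ENNReal.toReal_mul, ENNReal.toReal_inv, Set.inter_comm, measureReal_def, measureReal_def,
    div_eq_inv_mul]

theorem IsMRF.cyl_ratio (hμ : IsMRF μ) {x : Config d (ZMod r)} (hx : x ∈ μ.support)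
    {A B : Finset (Lattice d)} (hAB : boundary A ⊆ B) (hdisj : Disjoint A B) :
    μ.real (cyl (A ∪ B) ((A ∪ B).restrict x)) / μ.real (cyl B (B.restrict x)) =
      μ.real (cyl (A ∪ boundary A) ((A ∪ boundary A).restrict x)) /
        μ.real (cyl (boundary A) ((boundary A).restrict x)) := by
  have := hμ.prob
  rw [← cond_real_cyl, ← cond_real_cyl, measureReal_def, measureReal_def]
  congr 1
  refine hμ.markov A B hAB hdisj _ _ ?_
  have := cyl_real_pos hx B
  by_contra hc
  rw [not_lt, nonpos_iff_eq_zero] at hc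
  rw [measureReal_def, hc] at this
  simp at this

theorem subset_union_boundary {F A : Finset (Lattice d)} (h : F ⊆ A) :
    F ∪ boundary F ⊆ A ∪ boundary A := by
  intro n hn
  rw [Finset.mem_union] at hn ⊢
  by_cases hA : n ∈ A
  · exact Or.inl hA
  · rcases hn with hn | hn
    · exact Or.inl (h hn)
    · obtain ⟨_, m, hm, hmn⟩ := mem_boundary.1 hn
      exact Or.inr (mem_boundary.2 ⟨hA, m, h hm, hmn⟩)

/-- Since `x` and `y` agree off `A`, the conditioning cylinders on `Λ \ A` and on `∂A` are common to
both. The Markov property makes the conditional weights on `A` independent of the window, and the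
normalisations cancel in the ratio. -/
theorem IsMRF.ratio_eq (hμ : IsMRF μ) {x y : Config d (ZMod r)} (hx : x ∈ μ.support)
    (hy : y ∈ μ.support) {A Λ : Finset (Lattice d)} (hA : ∀ n ∉ A, x n = y n)
    (hΛ : A ∪ boundary A ⊆ Λ) :
    μ.real (cyl Λ (Λ.restrict y)) / μ.real (cyl Λ (Λ.restrict x)) =
      μ.real (cyl (A ∪ boundary A) ((A ∪ boundary A).restrict y)) /
        μ.real (cyl (A ∪ boundary A) ((A ∪ boundary A).restrict x)) := by
  classical
  have := hμ.prob
  have hAB : boundary A ⊆ Λ \ A := fun n hn => Finset.mem_sdiff.2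
    ⟨hΛ (Finset.mem_union_right _ hn), (mem_boundary.1 hn).1⟩
  have hu : A ∪ Λ \ A = Λ :=
    Finset.union_sdiff_of_subset (Finset.subset_union_left.trans hΛ)
  have e1 := hμ.cyl_ratio hx hAB Finset.disjoint_sdiff
  have e2 := hμ.cyl_ratio hy hAB Finset.disjoint_sdiff
  rw [hu] at e1 e2
  rw [cyl_restrict_congr (W := Λ \ A) (x := y) (y := x) fun n hn =>
      (hA n (Finset.mem_sdiff.1 hn).2).symm,
    cyl_restrict_congr (W := boundary A) (x := y) (y := x) fun n hn =>
      (hA n (mem_boundary.1 hn).1).symm] at e2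
  have p1 := cyl_real_pos hx Λ
  have p2 := cyl_real_pos hx (Λ \ A)
  have p3 := cyl_real_pos hx (A ∪ boundary A)
  have p4 := cyl_real_pos hx (boundary A)
  rw [div_eq_div_iff p2.ne' p4.ne'] at e1 e2
  rw [div_eq_div_iff p1.ne' p3.ne']
  apply mul_right_cancel₀ (mul_pos p2 p4).ne'
  linear_combination
    μ.real (cyl (A ∪ boundary A) ((A ∪ boundary A).restrict x)) *
        μ.real (cyl (Λ \ A) ((Λ \ A).restrict x)) * e2 -
      μ.real (cyl (A ∪ boundary A) ((A ∪ boundary A).restrict y)) *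
        μ.real (cyl (Λ \ A) ((Λ \ A).restrict x)) * e1

theorem ShiftInvariant.cyl_real (hinv : ShiftInvariant μ) (n : Lattice d) (W : Finset (Lattice d))
    (x : Config d (ZMod r)) :
    μ.real (cyl W (W.restrict (shift n x))) =
      μ.real (cyl (W.image fun m => m + n) ((W.image fun m => m + n).restrict x)) := by
  rw [measureReal_def, measureReal_def,
    ← (hinv n).measure_preimage (measurableSet_cyl _ _).nullMeasurableSet]
  congr 2
  ext z
  rw [Set.mem_preimage, mem_cyl_restrict, mem_cyl_restrict, Finset.forall_mem_image]
  rfl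

/-- A shift-invariant Markov random field has a Radon–Nikodym cocycle, and this is a shift-invariant
Markov cocycle on the support. -/
theorem exists_radonNikodymCocycle (hμ : IsMRF μ) (hinv : ShiftInvariant μ)
    {X : Set (Config d (ZMod r))} (hX : μ.support = X) :
    ∃ M : homoclinic X → ℝ, IsShiftInvariantMarkovCocycle M ∧ HasRadonNikodymCocycle μ M := by
  classical
  have := hμ.prob
  subst hX
  let D : homoclinic μ.support → Finset (Lattice d) := fun p => p.2.2.2.toFinset
  -- The definition uses the smallest admissible window; `hM` then allows any larger one, so that
  -- different pairs can be compared in a common window.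
  let M : homoclinic μ.support → ℝ := fun p => Real.log
    (μ.real (cyl (D p ∪ boundary (D p)) ((D p ∪ boundary (D p)).restrict p.1.2)) /
      μ.real (cyl (D p ∪ boundary (D p)) ((D p ∪ boundary (D p)).restrict p.1.1)))
  have hM : ∀ (x y : Config d (ZMod r)) (hxy : (x, y) ∈ homoclinic μ.support)
      (A Λ : Finset (Lattice d)), (∀ n ∉ A, x n = y n) → A ∪ boundary A ⊆ Λ →
      M ⟨(x, y), hxy⟩ =
        Real.log (μ.real (cyl Λ (Λ.restrict y)) / μ.real (cyl Λ (Λ.restrict x))) := by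
    intro x y hxy A Λ hA hΛ
    have hDA : D ⟨(x, y), hxy⟩ ⊆ A := fun n hn => by
      by_contra hc
      simp only [D, Set.Finite.mem_toFinset] at hn
      exact hn (hA n hc)
    have hD : ∀ n ∉ D ⟨(x, y), hxy⟩, x n = y n := fun n hn => by
      by_contra hc
      exact hn (by simp only [D, Set.Finite.mem_toFinset]; exact hc)
    rw [hμ.ratio_eq hxy.1 hxy.2.1 hD ((subset_union_boundary hDA).trans hΛ)]
  refine ⟨M, ⟨?_, ?_, ?_⟩, ?_⟩
  · intro x y z hxy hyz hxz
    let A := D ⟨_, hxy⟩ ∪ D ⟨_, hyz⟩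
    have h1 : ∀ n ∉ A, x n = y n := fun n hn => by
      by_contra hc; exact hn (by simp [A, D]; exact Or.inl hc)
    have h2 : ∀ n ∉ A, y n = z n := fun n hn => by
      by_contra hc; exact hn (by simp [A, D]; exact Or.inr hc)
    rw [hM x y hxy A _ h1 subset_rfl, hM y z hyz A _ h2 subset_rfl,
      hM x z hxz A _ (fun n hn => (h1 n hn).trans (h2 n hn)) subset_rfl]
    have p1 := cyl_real_pos hxy.1 (A ∪ boundary A)
    have p2 := cyl_real_pos hyz.1 (A ∪ boundary A)
    have p3 := cyl_real_pos hyz.2.1 (A ∪ boundary A)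
    simp only at p1 p2 p3
    rw [← Real.log_mul (div_pos p2 p1).ne' (div_pos p3 p2).ne']
    congr 1
    field_simp
  · intro F x y z w hxy hzw h1 h2 h3 h4
    rw [hM x y hxy F _ h1 subset_rfl, hM z w hzw F _ h2 subset_rfl,
      cyl_restrict_congr h3, cyl_restrict_congr h4]
  · intro n x y hxy hs
    let A := D ⟨_, hxy⟩ ∪ (D ⟨_, hs⟩).image fun m => m + n
    have hA : ∀ m ∉ A, x m = y m := fun m hm => by
      by_contra hc; exact hm (by simp [A, D]; exact Or.inl hc)
    have hs' : ∀ m ∉ D ⟨_, hs⟩, shift n x m = shift n y m := fun m hm => by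
      by_contra hc
      exact hm (by simp only [D, Set.Finite.mem_toFinset]; exact hc)
    -- This window is admissible for the shifted pair, and its translate by `n` contains `A ∪ ∂A`,
    -- so it is admissible for the original pair too.
    let Λ := D ⟨_, hs⟩ ∪ boundary (D ⟨_, hs⟩) ∪ (A ∪ boundary A).image fun m => m - n
    rw [hM _ _ hs _ Λ hs' Finset.subset_union_left, hinv.cyl_real, hinv.cyl_real]
    refine (hM x y hxy A _ hA fun m hm => ?_).symm
    rw [Finset.mem_image]
    exact ⟨m - n, Finset.mem_union_right _ (Finset.mem_image_of_mem _ hm), by abel⟩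
  · intro x y hxy hx hy F Λ hF hΛ
    rw [hM x y hxy F Λ (fun n hn => by by_contra hc; exact hn ((hF n).2 hc)) hΛ,
      Real.exp_log (div_pos (cyl_real_pos hy Λ) (cyl_real_pos hx Λ))]

end RadonNikodym

/-! ### Gibbs states -/

section GibbsStates

variable {d r : ℕ} {μ : Measure (Config d (ZMod r))}

theorem Interaction.weight_pat {X : Set (Config d (ZMod r))} (φ : Interaction X) (x : X)
    (W : Finset (Lattice d)) :
    φ.weight (pat x W) = Real.exp (∑ C ∈ W.powerset, φ C (pat x C)) := by
  rw [Real.exp_sum, ← Finset.prod_attach]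
  rfl

open Classical in
theorem Interaction.exists_partition_eq_sum {𝒜 : Type*} [Fintype 𝒜] {X : Set (Config d 𝒜)}
    (φ : Interaction X) (S : Set (Config d 𝒜)) (A : Finset (Lattice d)) (b : boundary A → 𝒜) :
    ∃ P : Finset (language X (A ∪ boundary A)),
      (∀ w, w ∈ P ↔ w.1 ∈ language S (A ∪ boundary A) ∧
        Finset.restrict₂ (π := fun _ => 𝒜) Finset.subset_union_right w.1 = b) ∧
      φ.partition S A b = ∑ w ∈ P, φ.weight w :=
  ⟨Finset.univ.filter fun w => w.1 ∈ language S (A ∪ boundary A) ∧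
        Finset.restrict₂ (π := fun _ => 𝒜) Finset.subset_union_right w.1 = b, by simp, by
    rw [Interaction.partition, Finset.sum_filter]⟩

open Classical in
/-- A Markov random field adapted to `X_r` whose Radon–Nikodym cocycle is the cocycle of a
nearest-neighbour interaction is a Gibbs state. -/
theorem isGibbsState_of_radonNikodym [NeZero r] (hr1 : r ≠ 1) (hr2 : r ≠ 2) (hr4 : r ≠ 4)
    (hμ : IsMRF μ) (had : Adapted μ (Xr d r)) {φ : Interaction (Xr d r)}
    (hφ : φ.IsNearestNeighbor) (hRN : HasRadonNikodymCocycle μ (gibbsCocycle φ)) :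
    IsGibbsState φ μ := by
  have := hμ.prob
  refine ⟨hμ, had.1, fun x hx A B hAB hdisj => ?_⟩
  rw [cond_real_cyl, hμ.cyl_ratio hx hAB hdisj]
  let W := A ∪ boundary A
  have key : ∀ w : language (Xr d r) W, (w.1 ∈ language μ.support W ∧
      Finset.restrict₂ (π := fun _ => ZMod r) Finset.subset_union_right w.1
        = (boundary A).restrict (x : Config d (ZMod r))) →
      μ.real (cyl W w.1) =
        μ.real (cyl W (W.restrict (x : Config d (ZMod r)))) / φ.weight (pat x W) * φ.weight w := by
    rintro w ⟨⟨z, hz, hzw⟩, hwb⟩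
    have hzx : ∀ n ∈ boundary A, x.1 n = z n := by
      intro n hn
      have := congrFun hwb ⟨n, hn⟩
      rw [← hzw] at this
      exact this.symm
    -- The pattern `w` comes from a support point `z` that need not be homoclinic to `x`. Splicing
    -- `z` inside `A` into `x` gives a homoclinic point with the pattern `w`, and adaptedness places
    -- it in the support.
    set y : Config d (ZMod r) := fun n => if n ∈ A then z n else x.1 n with hy
    have hyX : y ∈ Xr d r :=
      glue_mem_Xr (NeZero.ne r) hr1 hr2 hr4 x.2 (had.1 hz) A hzx
    have hxyA : ∀ n ∉ A, x.1 n = y n := fun n hn => by simp [hy, hn]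
    have hxy : (x.1, y) ∈ homoclinic (Xr d r) := ⟨x.2, hyX, A.finite_toSet.subset fun n hn => by
      by_contra hc; exact hn (hxyA n hc)⟩
    have hys : y ∈ μ.support := had.2 _ hx _ hxy
    have hyW : W.restrict y = w.1 := by
      rw [← hzw]
      refine cyl_restrict_congr fun n hn => ?_
      rcases Finset.mem_union.1 hn with hn | hn
      · simp [hy, hn]
      · rw [← hxyA n (mem_boundary.1 hn).1, hzx n hn]
    have hpat : w = pat ⟨y, hyX⟩ W := Subtype.ext hyW.symm
    have hF : hxy.2.2.toFinset ⊆ A := fun n hn => by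
      by_contra hc
      simp only [Set.Finite.mem_toFinset] at hn
      exact hn (hxyA n hc)
    have h1 := hRN x.1 y hxy hx hys hxy.2.2.toFinset W (fun n => by simp)
      (subset_union_boundary hF)
    rw [gibbsCocycle_eq_sum_powerset hφ hxy A hxyA, Finset.sum_sub_distrib, Real.exp_sub,
      ← Interaction.weight_pat, ← Interaction.weight_pat, ← hpat, hyW,
      div_eq_iff (cyl_real_pos hx W).ne'] at h1
    rw [h1]
    ring
  -- Up to a null set, the cylinder on `∂A` is the disjoint union of the cylinders of the admissible
  -- patterns on `W`, each of mass proportional to its weight by `key`.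
  have hsum : μ.real (cyl (boundary A) ((boundary A).restrict (x : Config d (ZMod r)))) =
      μ.real (cyl W (W.restrict (x : Config d (ZMod r)))) / φ.weight (pat x W) *
        φ.partition μ.support A ((boundary A).restrict (x : Config d (ZMod r))) := by
    obtain ⟨P, hP, hpart⟩ := φ.exists_partition_eq_sum μ.support A
      ((boundary A).restrict (x : Config d (ZMod r)))
    rw [hpart, Finset.mul_sum, ← Finset.sum_congr rfl fun w hw => key w ((hP w).1 hw),
      ← measureReal_biUnion_finset]
    · refine measureReal_congr ?_
      have hs : μ.support ∈ ae μ := Measure.support_mem_ae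
      filter_upwards [hs] with z hz
      refine propext ⟨fun h => ?_, fun h => ?_⟩
      · refine Set.mem_biUnion (x := (⟨W.restrict z, z, had.1 hz, rfl⟩ : language (Xr d r) W)) ?_ rfl
        exact (hP _).2 ⟨⟨z, hz, rfl⟩, h⟩
      · obtain ⟨w, hw, hzw⟩ := Set.mem_iUnion₂.1 h
        have h2 := ((hP w).1 hw).2
        rw [← mem_cyl.1 hzw] at h2
        exact h2
    · intro w _ w' _ hne
      refine Set.disjoint_left.2 fun z hz hz' => hne (Subtype.ext ?_)
      rw [← mem_cyl.1 hz, ← mem_cyl.1 hz']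
    · exact fun w _ => measurableSet_cyl _ _
  have p1 := cyl_real_pos hx W
  have p2 : 0 < φ.weight (pat x W) := by
    rw [Interaction.weight_pat]; exact Real.exp_pos _
  have p3 := cyl_real_pos hx (boundary A)
  rw [hsum] at p3 ⊢
  have p4 : φ.partition μ.support A ((boundary A).restrict (x : Config d (ZMod r))) ≠ 0 := by
    intro h0
    rw [h0, mul_zero] at p3
    exact lt_irrefl _ p3
  change μ.real (cyl W (W.restrict (x : Config d (ZMod r)))) / _ = φ.weight (pat x W) / _
  field_simp

end GibbsStates

/-! ### Recurrence -/

section Recurrence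

/-- If every point of the invariant set `D` visits `A`, then off a set of small measure the points of
`D` visit `A` with positive frequency. -/
theorem measure_few_visits_le {Ω : Type*} [MeasurableSpace Ω] {μ : Measure Ω} [IsFiniteMeasure μ]
    {T : Ω → Ω} (hT : MeasurePreserving T μ μ) {A D : Set Ω} [DecidablePred (· ∈ A)]
    (hA : MeasurableSet A)
    (hD : MeasurableSet D) (hTD : ∀ x ∈ D, T x ∈ D) (hvisit : ∀ x ∈ D, ∃ k : ℕ, T^[k] x ∈ A)
    {η : ENNReal} (hη : 0 < η) :
    ∃ K₀ : ℕ, ∀ K ≥ K₀, ∀ N : ℕ, 0 < N →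
      μ (D ∩ {x | 2 * K * ((Finset.range (N + K)).filter fun k => T^[k] x ∈ A).card < N}) ≤ η := by
  classical
  -- `G K` consists of the points that visit `A` before time `K`; the sets `D \ G K` decrease to the
  -- empty set.
  let G : ℕ → Set Ω := fun K => ⋃ k ∈ Finset.range K, T^[k] ⁻¹' A
  have hG : ∀ K, MeasurableSet (G K) := fun K =>
    Finset.measurableSet_biUnion _ fun k _ => (hT.iterate k).measurable hA
  have hlim : Filter.Tendsto (fun K => μ (D \ G K)) Filter.atTop (nhds 0) := by
    have h0 : μ (⋂ K, D \ G K) = 0 := by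
      have : (⋂ K, D \ G K) = ∅ := by
        rw [Set.eq_empty_iff_forall_notMem]
        intro x hx
        rw [Set.mem_iInter] at hx
        obtain ⟨k, hk⟩ := hvisit x (hx 0).1
        exact (hx (k + 1)).2 (Set.mem_biUnion (x := k) (by simp) hk)
      rw [this, measure_empty]
    rw [← h0]
    refine tendsto_measure_iInter_atTop (fun K => (hD.diff (hG K)).nullMeasurableSet) ?_
      ⟨0, measure_ne_top _ _⟩
    intro K L hKL
    refine Set.sdiff_subset_sdiff_right (Set.biUnion_subset_biUnion_left fun k hk => ?_)
    simp only [Finset.coe_range, Set.mem_Iio] at hk ⊢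
    omega
  obtain ⟨K₀, hK₀⟩ := Filter.eventually_atTop.1
    (hlim.eventually (ge_mem_nhds (ENNReal.half_pos hη.ne')))
  refine ⟨K₀, fun K hK N hN => ?_⟩
  have hDK := hK₀ K hK
  let f : Ω → ENNReal := fun x => ∑ k ∈ Finset.range N, (D \ G K).indicator 1 (T^[k] x)
  have hind : Measurable ((D \ G K).indicator (1 : Ω → ENNReal)) :=
    measurable_one.indicator (hD.diff (hG K))
  have hf : Measurable f :=
    Finset.measurable_sum _ fun k _ => hind.comp (hT.iterate k).measurable
  have hint : ∫⁻ x, 2 * f x ∂μ ≤ N * η := by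
    rw [lintegral_const_mul _ hf]
    simp only [f]
    rw [lintegral_finsetSum (f := fun k x => (D \ G K).indicator (1 : Ω → ENNReal) (T^[k] x)) _
      fun k _ => hind.comp (hT.iterate k).measurable]
    have : ∀ k ∈ Finset.range N,
        ∫⁻ x, (D \ G K).indicator (1 : Ω → ENNReal) (T^[k] x) ∂μ = μ (D \ G K) := by
      intro k _
      rw [(hT.iterate k).lintegral_comp hind, lintegral_indicator_one (hD.diff (hG K))]
    rw [Finset.sum_congr rfl this, Finset.sum_const, Finset.card_range, nsmul_eq_mul]
    calc 2 * ((N : ENNReal) * μ (D \ G K)) ≤ 2 * (N * (η / 2)) := by gcongr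
      _ = N * (2 * (η / 2)) := by ring
      _ = N * η := by rw [ENNReal.mul_div_cancel (by norm_num) (by norm_num)]
  have hsub : D ∩ {x | 2 * K * ((Finset.range (N + K)).filter fun k => T^[k] x ∈ A).card < N} ⊆
      {x | (N : ENNReal) ≤ 2 * f x} := by
    rintro x ⟨hxD, hx⟩
    change 2 * K * ((Finset.range (N + K)).filter fun k => T^[k] x ∈ A).card < N at hx
    set V := (Finset.range (N + K)).filter fun k => T^[k] x ∈ A with hV
    have hxk : ∀ k, T^[k] x ∈ D := by
      intro k
      induction k with
      | zero => exact hxD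
      | succ k ih => rw [Function.iterate_succ_apply']; exact hTD _ ih
    -- A time `k < N` with `T^[k] x ∈ G K` precedes a visit by fewer than `K` steps, so each visit
    -- before time `N + K` accounts for at most `K` such times. Few visits therefore force `f x ≥ N
    -- / 2`, which Markov's inequality makes unlikely.
    have hcard : ((Finset.range N).filter fun k => T^[k] x ∈ G K).card ≤ V.card * K := by
      have hs : ((Finset.range N).filter fun k => T^[k] x ∈ G K) ⊆
          (V ×ˢ Finset.range K).image fun p => p.1 - p.2 := by
        intro k hk
        rw [Finset.mem_filter, Finset.mem_range] at hk
        obtain ⟨l, hl, hlA⟩ := Set.mem_iUnion₂.1 hk.2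
        rw [Finset.mem_range] at hl
        rw [Set.mem_preimage, ← Function.iterate_add_apply] at hlA
        refine Finset.mem_image.2 ⟨(l + k, l), ?_, by simp⟩
        rw [Finset.mem_product, Finset.mem_filter, Finset.mem_range, Finset.mem_range]
        exact ⟨⟨by omega, hlA⟩, hl⟩
      calc _ ≤ _ := Finset.card_le_card hs
        _ ≤ (V ×ˢ Finset.range K).card := Finset.card_image_le
        _ = V.card * K := by rw [Finset.card_product, Finset.card_range]
    have hfx : f x = (((Finset.range N).filter fun k => T^[k] x ∉ G K).card : ENNReal) := by
      rw [Finset.card_filter]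
      push_cast
      refine Finset.sum_congr rfl fun k _ => ?_
      simp [Set.indicator_apply, hxk k]
    have htot := Finset.card_filter_add_card_filter_not (s := Finset.range N)
      (fun k => T^[k] x ∈ G K)
    rw [Finset.card_range] at htot
    have h2 : N ≤ 2 * ((Finset.range N).filter fun k => T^[k] x ∉ G K).card := by
      have h3 : 2 * K * V.card = 2 * (V.card * K) := by ring
      omega
    change (N : ENNReal) ≤ 2 * f x
    rw [hfx]
    exact_mod_cast h2
  have hN0 : (N : ENNReal) ≠ 0 := by exact_mod_cast hN.ne'
  have := (mul_meas_ge_le_lintegral (μ := μ) (hf.const_mul 2) N).trans hint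
  exact (measure_mono hsub).trans ((ENNReal.mul_le_mul_iff_right hN0 (ENNReal.natCast_ne_top N)).1 this)

variable {d r : ℕ}

theorem iterate_shift (v : Lattice d) (k : ℕ) (x : Config d (ZMod r)) :
    (shift v)^[k] x = shift (k • v) x := by
  induction k with
  | zero => funext n; simp [shift]
  | succ k ih =>
    rw [Function.iterate_succ_apply', ih]
    funext n
    simp only [shift, succ_nsmul]
    congr 1
    abel

theorem measurableSet_step [NeZero r] (n m : Lattice d) (s : ZMod r) :
    MeasurableSet {x : Config d (ZMod r) | x m - x n = s} :=
  measurableSet_eq_fun ((measurable_pi_apply m).sub (measurable_pi_apply n)) measurable_const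

/-- Almost every point is recurrent for the steps in every direction. -/
theorem ae_recurrent [NeZero r] {μ : Measure (Config d (ZMod r))} [IsFiniteMeasure μ]
    (hinv : ShiftInvariant μ) :
    ∀ᵐ x ∂μ, ∀ (n v : Lattice d) (s : ZMod r), x (n + v) - x n = s →
      ∃ᶠ k : ℕ in Filter.atTop, x (n + k • v + v) - x (n + k • v) = s := by
  rw [ae_all_iff]; intro n
  rw [ae_all_iff]; intro v
  rw [ae_all_iff]; intro s
  have hA : MeasurableSet {x : Config d (ZMod r) | x (n + v) - x n = s} := measurableSet_step _ _ _
  filter_upwards [(hinv v).conservative.ae_mem_imp_frequently_image_mem hA.nullMeasurableSet]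
    with x hx hs
  refine (hx hs).mono fun k hk => ?_
  rw [iterate_shift] at hk
  have hk' : x (n + v + k • v) - x (n + k • v) = s := hk
  rwa [add_right_comm] at hk'

/-- The configurations that have steps of both signs on every ray in a coordinate direction. -/
def oscillating (d r : ℕ) : Set (Config d (ZMod r)) :=
  {x | ∀ n v : Lattice d, l1dist 0 v = 1 → ∀ s : ℤ, s = 1 ∨ s = -1 →
    ∃ k : ℕ, x (n + k • v + v) - x (n + k • v) = s}

theorem measurableSet_oscillating [NeZero r] : MeasurableSet (oscillating d r) := by
  have : oscillating d r = ⋂ (n : Lattice d) (v : Lattice d) (_ : l1dist 0 v = 1) (s : ℤ)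
      (_ : s = 1 ∨ s = -1), ⋃ k : ℕ,
        {x : Config d (ZMod r) | x (n + k • v + v) - x (n + k • v) = s} := by
    ext x
    simp only [oscillating, Set.mem_iInter, Set.mem_iUnion]
    rfl
  rw [this]
  refine MeasurableSet.iInter fun n => MeasurableSet.iInter fun v => MeasurableSet.iInter fun _ =>
    MeasurableSet.iInter fun s => MeasurableSet.iInter fun _ => MeasurableSet.iUnion fun k => ?_
  exact measurableSet_step _ _ _

theorem shift_mem_oscillating {x : Config d (ZMod r)} (hx : x ∈ oscillating d r) (m : Lattice d) :
    shift m x ∈ oscillating d r := by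
  intro n v hv s hs
  obtain ⟨k, hk⟩ := hx (n + m) v hv s hs
  refine ⟨k, ?_⟩
  rw [← hk]
  simp only [shift]
  rw [add_right_comm n m, add_right_comm (n + k • v) m v]

/-- A recurrent point of `X_r` with a monotone coordinate ray is monotone on all the lines in that
direction. -/
theorem exists_monotone_direction (hr0 : r ≠ 0) (hr1 : r ≠ 1) (hr2 : r ≠ 2) {h : Config d ℤ}
    (hh : h ∈ Ht d)
    (hrec : ∀ (n v : Lattice d) (s : ZMod r), red r h (n + v) - red r h n = s →
      ∃ᶠ k : ℕ in Filter.atTop, red r h (n + k • v + v) - red r h (n + k • v) = s)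
    (hosc : red r h ∉ oscillating d r) :
    ∃ v : Lattice d, l1dist 0 v = 1 ∧ ∃ t : ℤ, (t = 1 ∨ t = -1) ∧ ∀ n, h (n + v) - h n = t := by
  have hrec' : ∀ (n v : Lattice d) (s : ℤ), l1dist 0 v = 1 → (s = 1 ∨ s = -1) → h (n + v) - h n = s →
      ∃ᶠ k : ℕ in Filter.atTop, h (n + k • v + v) - h (n + k • v) = s := by
    intro n v s hv hs hn
    refine (hrec n v s ((red_step_eq_iff hr0 hr1 hr2 hh (l1dist_add_of_unit hv n) hs).2 hn)).mono
      fun k hk => (red_step_eq_iff hr0 hr1 hr2 hh (l1dist_add_of_unit hv _) hs).1 hk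
  simp only [oscillating] at hosc
  have : ∃ n v : Lattice d, l1dist 0 v = 1 ∧ ∃ s : ℤ, (s = 1 ∨ s = -1) ∧
      ∀ k : ℕ, red r h (n + k • v + v) - red r h (n + k • v) ≠ s := by
    by_contra hc
    push Not at hc
    exact hosc hc
  obtain ⟨n, v, hv, s, hs, hray⟩ := this
  have hray' : ∀ k : ℕ, h (n + k • v + v) - h (n + k • v) ≠ s := fun k hk =>
    hray k ((red_step_eq_iff hr0 hr1 hr2 hh (l1dist_add_of_unit hv _) hs).2 hk)
  let H : Lattice d → Prop := fun n => ∀ k : ℤ, h (n + k • v + v) - h (n + k • v) = -s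
  have hstep : ∀ m, h (m + v) - h m = s ∨ h (m + v) - h m = -s := fun m => by
    have := Ht.step hh (l1dist_add_of_unit hv m)
    omega
  have hn : H n := by
    intro k
    refine (hstep _).resolve_left fun hk => ?_
    -- A step `s` anywhere on the line would recur; after at least `|k|` steps the recurrence falls
    -- on the ray where `s` never occurs.
    obtain ⟨j, hj, hjs⟩ := (Filter.frequently_atTop.1 (hrec' _ v s hv hs hk)) k.natAbs
    have e : n + k • v + j • v = n + (k + j).toNat • v := by
      have : (((k + j).toNat : ℤ)) = k + j := Int.toNat_of_nonneg (by omega)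
      rw [← natCast_zsmul, ← natCast_zsmul, this, add_smul, add_assoc]
    rw [e] at hjs
    exact hray' _ hjs
  have hnb : ∀ m u, l1dist 0 u = 1 → H m → H (m + u) := by
    intro m u hu hm k
    refine (hstep _).resolve_left fun hk => ?_
    obtain ⟨j, hj, hjs⟩ := (Filter.frequently_atTop.1 (hrec' _ v s hv hs hk)) 1
    -- Up to sign, `f` is the height difference between the neighbouring line and the line on which
    -- every step is `-s`. It takes values `±1`, never increases, and drops by 2 at each `s`-step of
    -- the neighbouring line. Hence at most one `s`-step is possible, whereas recurrence supplies a
    -- second one.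
    let f : ℕ → ℤ := fun j => -s * (h (m + u + k • v + j • v) - h (m + k • v + j • v))
    have hf1 : ∀ j, f j = 1 ∨ f j = -1 := by
      intro j
      have : l1dist (m + k • v + j • v) (m + u + k • v + j • v) = 1 := by
        have e : m + u + k • v + j • v = m + k • v + j • v + u := by abel
        rw [e]; exact l1dist_add_of_unit hu _
      have := Ht.step hh this
      simp only [f]
      rcases hs with rfl | rfl <;> omega
    have hf2 : ∀ j : ℕ, f (j + 1) =
        f j + (-s * (h (m + u + k • v + j • v + v) - h (m + u + k • v + j • v)) - 1) := by
      intro j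
      have h1 := hm (k + j)
      have e : m + (k + (j : ℤ)) • v = m + k • v + j • v := by
        rw [add_smul, natCast_zsmul, add_assoc]
      rw [e] at h1
      simp only [f, succ_nsmul, ← add_assoc]
      rcases hs with rfl | rfl <;> linarith
    have hanti : ∀ j : ℕ, f (j + 1) ≤ f j := by
      intro j
      rw [hf2]
      have := hstep (m + u + k • v + j • v)
      rcases hs with rfl | rfl <;> omega
    have hanti' : f j ≤ f 1 := antitone_nat_of_succ_le hanti hj
    have e0 := hf2 0
    have e1 := hf2 j
    simp only [zero_smul, add_zero, zero_add] at e0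
    rw [hk] at e0
    rw [hjs] at e1
    have a0 := hf1 0
    have a1 := hf1 1
    have a2 := hf1 j
    have a3 := hf1 (j + 1)
    rcases hs with rfl | rfl <;> omega
  have hall : ∀ m, H m := by
    intro m
    have := eq_of_forall_add_basisVec H (fun m i => propext
      ⟨fun hm => by
        have := hnb _ (-basisVec i) (l1dist_zero_eq_one_iff.2 ⟨i, Or.inr rfl⟩) hm
        rwa [add_neg_cancel_right] at this,
      fun hm => hnb _ _ (l1dist_zero_eq_one_iff.2 ⟨i, Or.inl rfl⟩) hm⟩) n m
    rw [← this]; exact hn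
  refine ⟨v, hv, -s, by omega, fun m => ?_⟩
  simpa using hall m 0

theorem l1dist_add_nsmul {v : Lattice d} (hv : l1dist 0 v = 1) (n : Lattice d) (k : ℕ) :
    l1dist n (n + k • v) = k := by
  obtain ⟨i, rfl | rfl⟩ := l1dist_zero_eq_one_iff.1 hv
  · have : (k : ℕ) • basisVec i = Pi.single i (k : ℤ) := by
      simp [basisVec, ← Pi.single_smul]
    rw [this, l1dist_zero_add_single]; simp
  · have : (k : ℕ) • -basisVec i = Pi.single i (-k : ℤ) := by
      simp [basisVec, ← Pi.single_smul, Pi.single_neg]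
    rw [this, l1dist_zero_add_single]; simp

/-- A point of `X_r` that is monotone in some coordinate direction is frozen. -/
theorem frozenPoint_of_monotone (hd : 2 ≤ d) (hr0 : r ≠ 0) (hr1 : r ≠ 1) (hr2 : r ≠ 2)
    {x : Config d (ZMod r)} (hx : x ∈ Xr d r) {v : Lattice d} (hv : l1dist 0 v = 1) {t : ℤ}
    (ht : t = 1 ∨ t = -1) (hxt : ∀ n, x (n + v) - x n = t) : FrozenPoint (Xr d r) x := by
  refine ⟨hx, fun y hxy => ?_⟩
  obtain ⟨h, hh, h', hh', rfl, rfl, hfin⟩ := exists_lift_pair hd hr0 hr1 hr2 hxy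
  have hst : ∀ n, h (n + v) - h n = t := fun n =>
    (red_step_eq_iff hr0 hr1 hr2 hh (l1dist_add_of_unit hv n) ht).1 (hxt n)
  have hline : ∀ n (k : ℕ), h (n + k • v) = h n + k * t := by
    intro n k
    induction k with
    | zero => simp
    | succ k ih =>
      have := hst (n + k • v)
      rw [succ_nsmul, ← add_assoc]
      push_cast
      linarith
  have hfar : ∀ n (u : Lattice d), l1dist 0 u = 1 → ∃ k₀ : ℕ, ∀ k ≥ k₀, h (n + k • u) = h' (n + k • u) := by
    intro n u hu
    have hinj : Function.Injective fun k : ℕ => n + k • u := by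
      intro k l hkl
      have h1 := l1dist_add_nsmul hu n k
      have h2 := l1dist_add_nsmul hu n l
      simp only at hkl
      rw [hkl, h2] at h1
      exact_mod_cast h1.symm
    have hf : {k : ℕ | h (n + k • u) ≠ h' (n + k • u)}.Finite := hfin.preimage hinj.injOn
    obtain ⟨b, hb⟩ := hf.bddAbove
    refine ⟨b + 1, fun k hk => ?_⟩
    by_contra hc
    have := hb hc
    omega
  funext n
  have hnv : l1dist 0 (-v) = 1 := by
    rw [← hv, l1dist_comm, ← l1dist_add_right v (-v) 0]; simp
  obtain ⟨k₁, hk₁⟩ := hfar n v hv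
  obtain ⟨k₂, hk₂⟩ := hfar n (-v) hnv
  let k := max k₁ k₂
  have a1 := hk₁ k (le_max_left _ _)
  have a2 := hk₂ k (le_max_right _ _)
  have b1 := hline n k
  have b2 := hline (n + k • -v) k
  have e : n + k • -v + k • v = n := by simp
  rw [e] at b2
  -- Far away in both directions `h'` equals `h`, which has slope `±1` along the line; the two
  -- Lipschitz bounds leave a single value at `n`.
  have c1 := Ht.lipschitz hh' n (n + k • v)
  have c2 := Ht.lipschitz hh' n (n + k • -v)
  rw [l1dist_add_nsmul hv, abs_le] at c1
  rw [l1dist_add_nsmul hnv, abs_le] at c2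
  have : h' n = h n := by
    rcases ht with rfl | rfl <;> omega
  simp [red, this]

/-- If almost no point oscillates then the field is frozen. -/
theorem frozenMeasure_of_oscillating_null [NeZero r] (hd : 2 ≤ d) (hr1 : r ≠ 1) (hr2 : r ≠ 2)
    {μ : Measure (Config d (ZMod r))} [IsFiniteMeasure μ] (hinv : ShiftInvariant μ)
    (hsupp : μ.support ⊆ Xr d r) (h0 : μ (oscillating d r) = 0) : FrozenMeasure (Xr d r) μ := by
  have hr0 := NeZero.ne r
  let C : Set (Config d (ZMod r)) := ⋃ v ∈ neighbors (0 : Lattice d), ⋃ t ∈ ({1, -1} : Finset ℤ),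
    {x | ∀ n, x (n + v) - x n = t}
  have hC : IsClosed C := by
    refine isClosed_biUnion_finset fun v _ => isClosed_biUnion_finset fun t _ => ?_
    have : {x : Config d (ZMod r) | ∀ n, x (n + v) - x n = t} =
        ⋂ n, {x : Config d (ZMod r) | x (n + v) - x n = t} := by ext x; simp
    rw [this]
    exact isClosed_iInter fun n =>
      isClosed_eq ((continuous_apply (n + v)).sub (continuous_apply n)) continuous_const
  -- Because `C` is closed, an almost sure statement passes to every point of the support.
  have hae : C ∈ ae μ := by
    have hs : μ.support ∈ ae μ := Measure.support_mem_ae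
    have h0' : ∀ᵐ x ∂μ, x ∉ oscillating d r := measure_eq_zero_iff_ae_notMem.1 h0
    filter_upwards [hs, h0', ae_recurrent hinv] with x hx hosc hrec
    obtain ⟨h, hh, rfl⟩ := exists_red_eq (hsupp hx)
    obtain ⟨v, hv, t, ht, hmono⟩ := exists_monotone_direction hr0 hr1 hr2 hh hrec hosc
    refine Set.mem_biUnion (mem_neighbors.2 hv) (Set.mem_biUnion (x := t) (by simpa using ht) ?_)
    exact fun n => (red_step_eq_iff hr0 hr1 hr2 hh (l1dist_add_of_unit hv n) ht).2 (hmono n)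
  intro x hx
  obtain ⟨v, hv, hx'⟩ := Set.mem_iUnion₂.1 (Measure.support_subset_of_isClosed hC hae hx)
  obtain ⟨t, ht, hx''⟩ := Set.mem_iUnion₂.1 hx'
  exact frozenPoint_of_monotone hd hr0 hr1 hr2 (hsupp hx) (mem_neighbors.1 hv)
    (by simpa using ht) hx''

/-- The number of steps of sign `s` among the first `L` steps on the ray from the origin in the
direction `v`. -/
def stepCount (x : Config d (ZMod r)) (v : Lattice d) (s : ℤ) (L : ℕ) : ℕ :=
  ((Finset.range L).filter fun k : ℕ => x (k • v + v) - x (k • v) = s).card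

/-- If oscillating points have positive measure then, with probability bounded below, both signs have
positive frequency on all the coordinate rays from the origin. -/
theorem exists_stepCount_bound [NeZero r] {μ : Measure (Config d (ZMod r))} [IsFiniteMeasure μ]
    (hinv : ShiftInvariant μ) (hpos : μ (oscillating d r) ≠ 0) :
    ∃ K : ℕ, 0 < K ∧ ∃ ε : ℝ, 0 < ε ∧ ∀ N : ℕ, 0 < N → ε ≤ μ.real {x | ∀ v, l1dist 0 v = 1 →
      ∀ s : ℤ, s = 1 ∨ s = -1 → N ≤ 2 * K * stepCount x v s (N + K)} := by
  classical
  let D := oscillating d r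
  let P : Finset (Lattice d × ℤ) := neighbors 0 ×ˢ {1, -1}
  set p := μ.real D with hp
  have hp0 : 0 < p := ENNReal.toReal_pos hpos (measure_ne_top _ _)
  -- The exceptional sets, one for each pair of a direction and a sign, then remove at most half of
  -- the mass `p`.
  set η : ℝ := p / (2 * (P.card + 1)) with hη
  have hη0 : 0 < η := by positivity
  let Bad : Lattice d × ℤ → ℕ → ℕ → Set (Config d (ZMod r)) := fun q K N =>
    D ∩ {x | 2 * K * stepCount x q.1 q.2 (N + K) < N}
  have key : ∀ q : Lattice d × ℤ, ∃ K₀ : ℕ, q ∈ P → ∀ K ≥ K₀, ∀ N : ℕ, 0 < N →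
      μ.real (Bad q K N) ≤ η := by
    intro q
    by_cases hq : q ∈ P
    · obtain ⟨v, s⟩ := q
      rw [Finset.mem_product, mem_neighbors] at hq
      have hs : s = 1 ∨ s = -1 := by simpa using hq.2
      have hA : MeasurableSet {x : Config d (ZMod r) | x v - x 0 = s} := measurableSet_step _ _ _
      obtain ⟨K₀, hK₀⟩ := measure_few_visits_le (hinv v) hA
        measurableSet_oscillating (fun x hx => shift_mem_oscillating hx v) (fun x hx => by
          obtain ⟨k, hk⟩ := hx 0 v hq.1 s hs
          refine ⟨k, ?_⟩
          rw [iterate_shift]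
          change x (v + k • v) - x (0 + k • v) = s
          rw [← hk]
          simp [add_comm]) (η := ENNReal.ofReal η) (by simpa using hη0)
      refine ⟨K₀, fun _ K hK N hN => ?_⟩
      refine ENNReal.toReal_le_of_le_ofReal hη0.le ((le_of_eq ?_).trans (hK₀ K hK N hN))
      congr 1
      ext x
      have : stepCount x v s (N + K) = ((Finset.range (N + K)).filter fun k =>
          (shift v)^[k] x ∈ {x : Config d (ZMod r) | x v - x 0 = s}).card := by
        rw [stepCount]
        congr 1
        refine Finset.filter_congr fun k _ => ?_
        rw [iterate_shift]
        change _ ↔ x (v + k • v) - x (0 + k • v) = s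
        rw [zero_add, add_comm v]
      change (x ∈ D ∧ 2 * K * stepCount x v s (N + K) < N) ↔ (x ∈ D ∧ 2 * K * _ < N)
      rw [this]
    · exact ⟨0, fun h => absurd h hq⟩
  choose K₀ hK₀ using key
  let K := P.sup K₀ + 1
  refine ⟨K, by simp [K], p / 2, by positivity, fun N hN => ?_⟩
  set Good : Set (Config d (ZMod r)) := {x | ∀ v, l1dist 0 v = 1 →
      ∀ s : ℤ, s = 1 ∨ s = -1 → N ≤ 2 * K * stepCount x v s (N + K)} with hGood
  have hcover : D ⊆ Good ∪ ⋃ q ∈ P, Bad q K N := by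
    intro x hx
    by_cases hg : x ∈ Good
    · exact Or.inl hg
    · right
      simp only [hGood] at hg
      have : ∃ v, l1dist 0 v = 1 ∧ ∃ s : ℤ, (s = 1 ∨ s = -1) ∧
          2 * K * stepCount x v s (N + K) < N := by
        by_contra hc
        push Not at hc
        exact hg hc
      obtain ⟨v, hv, s, hs, hlt⟩ := this
      exact Set.mem_biUnion (x := (v, s))
        (Finset.mem_product.2 ⟨mem_neighbors.2 hv, by simpa using hs⟩) ⟨hx, hlt⟩
  have h1 : p ≤ μ.real Good + P.card * η := by
    calc p ≤ μ.real (Good ∪ ⋃ q ∈ P, Bad q K N) := measureReal_mono hcover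
      _ ≤ μ.real Good + μ.real (⋃ q ∈ P, Bad q K N) := measureReal_union_le _ _
      _ ≤ μ.real Good + ∑ q ∈ P, μ.real (Bad q K N) := by
          gcongr; exact measureReal_biUnion_finset_le _ _
      _ ≤ μ.real Good + ∑ q ∈ P, η := by
          gcongr with q hq
          exact hK₀ q hq K ((Finset.le_sup hq).trans (Nat.le_succ _)) N hN
      _ = μ.real Good + P.card * η := by rw [Finset.sum_const, nsmul_eq_mul]
  have h2 : P.card * η ≤ p / 2 := by
    rw [hη, mul_div_assoc', div_le_div_iff₀ (by positivity) (by norm_num)]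
    nlinarith
  linarith

end Recurrence

/-! ### Surgery on height functions -/

section Surgery

variable {d r : ℕ}

open Classical in
/-- Height functions that agree on the sphere of radius `N` (in the sup norm) can be glued there. -/
theorem Ht.glue {h g : Config d ℤ} (hh : h ∈ Ht d) (hg : g ∈ Ht d) (N : ℤ)
    (hs : ∀ n, (∃ j, |n j| = N) → h n = g n) :
    (fun n => if ∀ j, |n j| ≤ N then g n else h n) ∈ Ht d := by
  have key : ∀ n m : Lattice d, l1dist n m = 1 → (∀ j, |n j| ≤ N) → ¬ (∀ j, |m j| ≤ N) →
      h n = g n := by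
    intro n m hnm hn hm
    push Not at hm
    obtain ⟨j, hj⟩ := hm
    refine hs n ⟨j, ?_⟩
    have h1 := abs_sub_le_l1dist n m j
    have h2 := hn j
    rw [hnm] at h1
    have h3 := abs_sub_abs_le_abs_sub (m j) (n j)
    rw [abs_sub_comm] at h3
    omega
  intro n m hnm
  by_cases hn : ∀ j, |n j| ≤ N <;> by_cases hm : ∀ j, |m j| ≤ N
  · simp only [hn, hm, implies_true, if_true]; exact hg n m hnm
  · simp only [if_pos hn, if_neg hm, ← key n m hnm hn hm]; exact hh n m hnm
  · simp only [if_neg hn, if_pos hm, ← key m n (by rw [l1dist_comm]; exact hnm) hm hn]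
    exact hh n m hnm
  · simp only [if_neg hn, if_neg hm]; exact hh n m hnm

/-- Slack along the axes gives slack on the whole sphere. -/
theorem Ht.abs_sub_le_of_slack {h : Config d ℤ} (hh : h ∈ Ht d) {N : ℕ} {S : ℤ}
    (hS : ∀ v, l1dist 0 v = 1 → |h (N • v) - h 0| ≤ N - S) {n : Lattice d}
    (hn : ∃ j, |n j| = (N : ℤ)) : |h n - h 0| ≤ l1dist 0 n - S := by
  obtain ⟨j, hj⟩ := hn
  obtain ⟨v, hv, hvj, hvi⟩ : ∃ v : Lattice d, l1dist 0 v = 1 ∧ (N : ℤ) * v j = n j ∧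
      ∀ i, i ≠ j → v i = 0 := by
    rcases (abs_eq (by positivity)).1 hj with h1 | h1
    · exact ⟨basisVec j, l1dist_zero_eq_one_iff.2 ⟨j, Or.inl rfl⟩, by simp [basisVec, h1],
        fun i hi => by simp [basisVec, Pi.single_eq_of_ne hi]⟩
    · exact ⟨-basisVec j, l1dist_zero_eq_one_iff.2 ⟨j, Or.inr rfl⟩, by simp [basisVec, h1],
        fun i hi => by simp [basisVec, Pi.single_eq_of_ne hi]⟩
  -- The axis point `N • v` lies on an `ℓ¹`-geodesic from 0 to `n`, so the Lipschitz bound from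
  -- there to `n` loses none of the slack.
  have e1 : l1dist n (N • v) = l1dist 0 n - N := by
    rw [l1dist, l1dist, ← Finset.add_sum_erase _ _ (Finset.mem_univ j),
      ← Finset.add_sum_erase (a := j) _ (fun i => |(0 : Lattice d) i - n i|) (Finset.mem_univ j)]
    have e2 : (N • v) j = n j := by rw [← hvj]; simp
    have e3 : ∑ i ∈ Finset.univ.erase j, |n i - (N • v) i|
        = ∑ i ∈ Finset.univ.erase j, |(0 : Lattice d) i - n i| :=
      Finset.sum_congr rfl fun i hi => by simp [hvi i (Finset.ne_of_mem_erase hi)]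
    rw [e2, e3]
    simp [hj]
  have h1 := Ht.lipschitz hh n (N • v)
  have h2 := hS v hv
  rw [e1] at h1
  have := abs_sub_le (h n) (h (N • v)) (h 0)
  omega

/-- A height function with slack can be raised by a cone inside a box. -/
theorem Ht.exists_raise {h : Config d ℤ} (hh : h ∈ Ht d) {N : ℕ} {t : ℤ}
    (hS : ∀ v, l1dist 0 v = 1 → |h (N • v) - h 0| ≤ N - 2 * t) :
    ∃ h' ∈ Ht d, (∀ n, h n ≤ h' n) ∧ (∀ n, (∃ j, (N : ℤ) ≤ |n j|) → h' n = h n) ∧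
      ∀ n, (∀ j, |n j| ≤ (N : ℤ)) → 2 * t - 2 * l1dist 0 n ≤ h' n - h n := by
  classical
  have hcone : (fun n : Lattice d => (h 0 + 2 * t) - l1dist 0 n) ∈ Ht d := negCone_mem_Ht _
  have hg := Ht.sup_mem hh hcone (Ht.parity hh hcone (k := 0) (by simp [l1dist_self]))
  -- On the sphere the slack already keeps `h` above the inserted cone, so taking the maximum
  -- changes nothing there.
  have hsph : ∀ n : Lattice d, (∃ j, |n j| = (N : ℤ)) →
      h n = max (h n) ((h 0 + 2 * t) - l1dist 0 n) := by
    intro n hn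
    have := Ht.abs_sub_le_of_slack hh hS hn
    rw [abs_le] at this
    rw [eq_comm, max_eq_left]
    omega
  refine ⟨_, Ht.glue hh hg N hsph, fun n => ?_, fun n hn => ?_, fun n hn => ?_⟩
  · split_ifs
    · exact le_max_left _ _
    · exact le_rfl
  · split_ifs with hb
    · obtain ⟨j, hj⟩ := hn
      exact (hsph n ⟨j, le_antisymm (hb j) hj⟩).symm
    · rfl
  · simp only [if_pos hn]
    have := Ht.lipschitz hh n 0
    rw [l1dist_comm, abs_le] at this
    have h2 := le_max_right (h n) ((h 0 + 2 * t) - l1dist 0 n)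
    omega

/-- The step counts determine the change of height along a ray. -/
theorem stepCount_height (hr0 : r ≠ 0) (hr1 : r ≠ 1) (hr2 : r ≠ 2) {h : Config d ℤ} (hh : h ∈ Ht d)
    {v : Lattice d} (hv : l1dist 0 v = 1) (L : ℕ) :
    (stepCount (red r h) v 1 L : ℤ) + stepCount (red r h) v (-1) L = L ∧
      h (L • v) - h 0 = (stepCount (red r h) v 1 L : ℤ) - stepCount (red r h) v (-1) L := by
  have hstep := fun k : ℕ => Ht.step hh (l1dist_add_of_unit hv (k • v))
  have hc : ∀ s : ℤ, s = 1 ∨ s = -1 → ∀ L, stepCount (red r h) v s L =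
      ∑ k ∈ Finset.range L, if h (k • v + v) - h (k • v) = s then 1 else 0 := by
    intro s hs L
    rw [stepCount, Finset.card_filter]
    refine Finset.sum_congr rfl fun k _ => ?_
    simp only [red_step_eq_iff hr0 hr1 hr2 hh (l1dist_add_of_unit hv (k • v)) hs]
  rw [hc 1 (Or.inl rfl), hc (-1) (Or.inr rfl)]
  induction L with
  | zero => simp
  | succ L ih =>
    rw [Finset.sum_range_succ, Finset.sum_range_succ, succ_nsmul]
    have := hstep L
    split_ifs <;> omega

/-- Every pair of opposite steps lowers the maximal displacement `L` by 2. -/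
theorem abs_sub_le_of_stepCount (hr0 : r ≠ 0) (hr1 : r ≠ 1) (hr2 : r ≠ 2) {h : Config d ℤ}
    (hh : h ∈ Ht d) {v : Lattice d} (hv : l1dist 0 v = 1) {L t : ℕ}
    (ht : ∀ s : ℤ, s = 1 ∨ s = -1 → t ≤ stepCount (red r h) v s L) :
    |h (L • v) - h 0| ≤ L - 2 * (t : ℤ) := by
  obtain ⟨h1, h2⟩ := stepCount_height hr0 hr1 hr2 hh hv L
  have h3 := ht 1 (Or.inl rfl)
  have h4 := ht (-1) (Or.inr rfl)
  rw [abs_le]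
  omega

/-- Any pattern can be implanted in a height function with enough slack. -/
theorem Ht.exists_implant [NeZero r] (i : Fin d) {h a : Config d ℤ} (hh : h ∈ Ht d) (ha : a ∈ Ht d)
    {N : ℕ} {L : ℤ} (hL : 0 ≤ L)
    (hS : ∀ v, l1dist 0 v = 1 → |h (N • v) - h 0| ≤ N - (2 * L + 2 * r))
    (hpar : (a 0 - h 0) % 2 = 0) :
    ∃ h' ∈ Ht d, {n | h n ≠ h' n}.Finite ∧ ∀ n, l1dist 0 n ≤ L → red r h' n = red r a n := by
  classical
  have hr : (0 : ℤ) < r := by exact_mod_cast Nat.pos_of_ne_zero (NeZero.ne r)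
  -- A multiple of `2 * r` changes neither the colours nor the parity; it brings `a 0` into `[h 0, h
  -- 0 + 2 r)`.
  set c : ℤ := -(2 * r * ((a 0 - h 0) / (2 * r))) with hc
  have hmod : a 0 + c - h 0 = (a 0 - h 0) % (2 * r) := by
    rw [hc, Int.emod_def]; ring
  have hb1 : h 0 ≤ a 0 + c := by
    have := Int.emod_nonneg (a 0 - h 0) (b := 2 * (r : ℤ)) (by omega)
    omega
  have hb2 : a 0 + c ≤ h 0 + 2 * r := by
    have := Int.emod_lt_of_pos (a 0 - h 0) (b := 2 * (r : ℤ)) (by omega)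
    omega
  have hc2 : c % 2 = 0 := by rw [hc, mul_assoc, ← mul_neg]; omega
  set b : Config d ℤ := fun n => a n + c with hb
  have hbH : b ∈ Ht d := Ht.add_const ha c
  have hb0 : b 0 = a 0 + c := rfl
  -- Two cones with tips at `b 0 ± 2 L` clip `b` to lower and upper barriers. Both barriers equal
  -- `b` on the ball of radius `L`, since `b` is Lipschitz, so clamping `h` between them gives `b`
  -- there. On the sphere `h` already lies between them: of its slack, `2 L` covers the cones and `2
  -- r` the offset of `b 0` from `h 0`.
  have hP : (fun n : Lattice d => (b 0 + 2 * L) - l1dist 0 n) ∈ Ht d := negCone_mem_Ht _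
  have hQ : (fun n : Lattice d => (b 0 - 2 * L) + l1dist 0 n) ∈ Ht d := cone_mem_Ht _
  have p1 := Ht.parity hbH hP (k := 0) (by simp only [l1dist_self]; omega)
  have p2 := Ht.parity hbH hQ (k := 0) (by simp only [l1dist_self]; omega)
  have p3 := Ht.parity hh hbH (k := 0) (by omega)
  have hlow := Ht.inf_mem hbH hP p1
  have hupp := Ht.sup_mem hbH hQ p2
  have hmid := Ht.inf_mem hh hupp fun n => by have := p2 n; have := p3 n; omega
  have hg := Ht.sup_mem hmid hlow fun n => by
    have := p1 n; have := p2 n; have := p3 n; omega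
  have hsph : ∀ n : Lattice d, (∃ j, |n j| = (N : ℤ)) →
      h n = max (min (h n) (max (b n) ((b 0 - 2 * L) + l1dist 0 n)))
        (min (b n) ((b 0 + 2 * L) - l1dist 0 n)) := by
    intro n hn
    have := Ht.abs_sub_le_of_slack hh hS hn
    rw [abs_le] at this
    omega
  have hLN : L ≤ N := by
    have := hS (basisVec i) (l1dist_zero_eq_one_iff.2 ⟨i, Or.inl rfl⟩)
    have h0 := abs_nonneg (h (N • basisVec i) - h 0)
    omega
  refine ⟨_, Ht.glue hh hg N hsph, ?_, fun n hn => ?_⟩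
  · refine (Set.finite_Icc (fun _ : Fin d => -(N : ℤ)) (fun _ => (N : ℤ))).subset fun n hn => ?_
    by_contra hc
    apply hn
    rw [if_neg]
    exact fun hb => hc ⟨fun j => (abs_le.1 (hb j)).1, fun j => (abs_le.1 (hb j)).2⟩
  · have hbox : ∀ j, |n j| ≤ (N : ℤ) := by
      intro j
      have := abs_sub_le_l1dist 0 n j
      simp only [Pi.zero_apply, zero_sub, abs_neg] at this
      omega
    have hlip := Ht.lipschitz hbH n 0
    rw [l1dist_comm, abs_le] at hlip
    have hval : max (min (h n) (max (b n) ((b 0 - 2 * L) + l1dist 0 n)))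
        (min (b n) ((b 0 + 2 * L) - l1dist 0 n)) = b n := by omega
    simp only [red, if_pos hbox]
    rw [hval]
    simp only [hb, hc]
    push_cast
    simp

end Surgery

/-! ### The support of a field that is not frozen -/

section Support

variable {d r : ℕ} {μ : Measure (Config d (ZMod r))}

/-- Enough slack lets any finite pattern be implanted by a homoclinic change, which keeps an adapted
field inside its support; the support is closed, so it contains every point of `X_r`. -/
theorem support_eq_Xr_of_slack [NeZero r] (i : Fin d) (hinv : ShiftInvariant μ)
    (had : Adapted μ (Xr d r))
    (hslack : ∀ S : ℤ, ∃ h ∈ Ht d, red r h ∈ μ.support ∧ ∃ N : ℕ, ∀ v, l1dist 0 v = 1 →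
      |h (N • v) - h 0| ≤ N - S) : μ.support = Xr d r := by
  refine Set.Subset.antisymm had.1 fun x hx => ?_
  obtain ⟨a, ha, rfl⟩ := exists_red_eq hx
  refine mem_of_isClosed_of_forall_exists Measure.isClosed_support fun W => ?_
  set L : ℤ := ∑ n ∈ W, (l1dist 0 n + l1dist (basisVec i) n) with hL
  have hLn : ∀ n ∈ W, l1dist 0 n + l1dist (basisVec i) n ≤ L := fun n hn =>
    Finset.single_le_sum (f := fun n => l1dist 0 n + l1dist (basisVec i) n)
      (fun _ _ => add_nonneg (l1dist_nonneg _ _) (l1dist_nonneg _ _)) hn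
  have hL0 : 0 ≤ L := Finset.sum_nonneg fun _ _ => add_nonneg (l1dist_nonneg _ _) (l1dist_nonneg _ _)
  obtain ⟨h, hh, hsupp, N, hN⟩ := hslack (2 * L + 2 * r)
  -- Implanting needs equal parities. If they differ at the origin, the target is first translated
  -- by one unit vector, which is why `L` also measures distances from `basisVec i`; the shift by
  -- `-v` undoes this.
  obtain ⟨v, hv, hpar⟩ : ∃ v : Lattice d, (v = 0 ∨ v = basisVec i) ∧ (a (0 + v) - h 0) % 2 = 0 := by
    by_cases hp : (a 0 - h 0) % 2 = 0
    · exact ⟨0, Or.inl rfl, by simpa using hp⟩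
    · refine ⟨basisVec i, Or.inr rfl, ?_⟩
      have := Ht.step ha (l1dist_add_basisVec i 0)
      omega
  obtain ⟨h', hh', hfin, hval⟩ := Ht.exists_implant (r := r) i hh (Ht.translate ha v) hL0 hN hpar
  refine ⟨shift (-v) (red r h'),
    shift_mem_support hinv (had.2 _ hsupp _ (homoclinic_red hh hh' hfin)) _, fun n hn => ?_⟩
  have hd1 : l1dist 0 (n + -v) ≤ L := by
    have e : l1dist 0 (n + -v) = l1dist v n := by
      rw [← l1dist_add_right v 0 (n + -v)]; simp
    have := hLn n hn
    have := l1dist_nonneg 0 n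
    have := l1dist_nonneg (basisVec i) n
    rw [e]
    rcases hv with rfl | rfl <;> omega
  change red r h' (n + -v) = _
  rw [hval _ hd1]
  simp [red]

/-- A shift-invariant field adapted to `X_r` for which oscillating points have positive measure has
full support. -/
theorem support_eq_Xr_of_oscillating [NeZero r] (i : Fin d) (hr1 : r ≠ 1) (hr2 : r ≠ 2)
    [IsFiniteMeasure μ] (hinv : ShiftInvariant μ) (had : Adapted μ (Xr d r))
    (hpos : μ (oscillating d r) ≠ 0) : μ.support = Xr d r := by
  refine support_eq_Xr_of_slack i hinv had fun S => ?_
  obtain ⟨K, hK, ε, hε, hN⟩ := exists_stepCount_bound hinv hpos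
  -- With `2 K t` in the frequency bound, each sign occurs at least `t` times on each axis, giving
  -- slack `2 t ≥ S`.
  set t : ℕ := S.toNat + 1 with ht
  have hpos' := hε.trans_le (hN (2 * K * t) (by positivity))
  have : 0 < μ {x | ∀ v, l1dist 0 v = 1 → ∀ s : ℤ, s = 1 ∨ s = -1 →
      2 * K * t ≤ 2 * K * stepCount x v s (2 * K * t + K)} := by
    by_contra hc
    rw [not_lt, nonpos_iff_eq_zero] at hc
    rw [measureReal_def, hc] at hpos'
    simp at hpos'
  obtain ⟨x, hx, hxs⟩ := Measure.nonempty_inter_support_of_pos this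
  obtain ⟨h, hh, rfl⟩ := exists_red_eq (had.1 hxs)
  refine ⟨h, hh, hxs, 2 * K * t + K, fun v hv => ?_⟩
  have := abs_sub_le_of_stepCount (NeZero.ne r) hr1 hr2 hh hv (t := t) (L := 2 * K * t + K)
    fun s hs => Nat.le_of_mul_le_mul_left (hx v hv s hs) (by positivity)
  have hS := Int.self_le_toNat S
  push_cast at this ⊢
  omega

end Support

/-! ### The height part of a Radon–Nikodym cocycle vanishes -/

section HeightPart

variable {d r : ℕ} {μ : Measure (Config d (ZMod r))}

theorem abs_cycleWeight_le [NeZero r] (e : ZMod r → ℝ) (a b : ZMod r) :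
    |cycleWeight e a b| ≤ ∑ c, |e c| := by
  rw [cycleWeight]
  split_ifs <;>
    exact Finset.single_le_sum (f := fun c => |e c|) (fun _ _ => abs_nonneg _) (Finset.mem_univ _)

/-- The box of radius `N` about the origin. -/
noncomputable def box (d : ℕ) (N : ℕ) : Finset (Lattice d) :=
  Finset.Icc (fun _ => -(N : ℤ)) (fun _ => (N : ℤ))

theorem mem_box {N : ℕ} {n : Lattice d} : n ∈ box d N ↔ ∀ j, |n j| ≤ (N : ℤ) := by
  rw [box, Finset.mem_Icc]
  exact ⟨fun h j => abs_le.2 ⟨h.1 j, h.2 j⟩,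
    fun h => ⟨fun j => (abs_le.1 (h j)).1, fun j => (abs_le.1 (h j)).2⟩⟩

theorem card_box (N : ℕ) : (box d N).card = (2 * N + 1) ^ d := by
  rw [box, Pi.card_Icc]
  simp only [Int.card_Icc, Finset.prod_const, Finset.card_univ, Fintype.card_fin]
  congr 1
  omega

/-- A height function with slack has a modification inside a box that changes the total height by a
large amount, in the direction of the sign of `α`. -/
theorem Ht.exists_gain {h : Config d ℤ} (hh : h ∈ Ht d) {N u : ℕ} (α : ℝ) (hd : 0 < d)
    (hu : 2 * d * u ≤ N)
    (hS : ∀ v, l1dist 0 v = 1 → |h (N • v) - h 0| ≤ N - 2 * (2 * d * u : ℕ)) :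
    ∃ h' ∈ Ht d, (∀ n, (∃ j, (N : ℤ) ≤ |n j|) → h' n = h n) ∧
      |α| * ((u + 1) ^ d * u) ≤ α * ∑ n ∈ box d N, ((h' n : ℝ) - h n) := by
  have key : ∀ g ∈ Ht d, (∀ v, l1dist 0 v = 1 → |g (N • v) - g 0| ≤ N - 2 * (2 * d * u : ℕ)) →
      ∃ g' ∈ Ht d, (∀ n, (∃ j, (N : ℤ) ≤ |n j|) → g' n = g n) ∧
        ((u : ℝ) + 1) ^ d * u ≤ ∑ n ∈ box d N, ((g' n : ℝ) - g n) := by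
    intro g hg hgS
    obtain ⟨g', hg', hle, hout, hin⟩ := Ht.exists_raise hg hgS
    refine ⟨g', hg', hout, ?_⟩
    -- On this cube `l1dist 0 n ≤ d u`, so the cone of height parameter `2 d u` raises each site by
    -- at least `4 d u - 2 d u ≥ u`.
    let Q : Finset (Lattice d) := Finset.Icc (fun _ => (0 : ℤ)) (fun _ => (u : ℤ))
    have hQcard : Q.card = (u + 1) ^ d := by
      simp only [Q]
      rw [Pi.card_Icc]
      simp only [Int.card_Icc, Finset.prod_const, Finset.card_univ, Fintype.card_fin]
      congr 1
    have hud : u ≤ d * u := Nat.le_mul_of_pos_left u hd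
    have hQ : ∀ n ∈ Q, n ∈ box d N ∧ (u : ℝ) ≤ (g' n : ℝ) - g n := by
      intro n hn
      rw [Finset.mem_Icc] at hn
      have hj : ∀ j, |n j| ≤ (u : ℤ) := fun j => by
        have h1 : (0 : ℤ) ≤ n j := hn.1 j
        have h2 : n j ≤ (u : ℤ) := hn.2 j
        rw [abs_of_nonneg h1]; exact h2
      have hjN : ∀ j, |n j| ≤ (N : ℤ) := fun j => (hj j).trans (by
        have : u ≤ N := by rw [mul_assoc] at hu; omega
        exact_mod_cast this)
      have hl : l1dist 0 n ≤ d * u := by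
        calc l1dist 0 n = ∑ j, |n j| := by simp [l1dist]
          _ ≤ ∑ _j : Fin d, (u : ℤ) := Finset.sum_le_sum fun j _ => hj j
          _ = d * u := by simp
      have h3 := hin n hjN
      have h4 : (u : ℤ) ≤ g' n - g n := by
        push_cast at h3
        have : (u : ℤ) ≤ d * u := by exact_mod_cast hud
        nlinarith
      exact ⟨mem_box.2 hjN, by exact_mod_cast h4⟩
    calc ((u : ℝ) + 1) ^ d * u = ∑ n ∈ Q, (u : ℝ) := by
          rw [Finset.sum_const, hQcard, nsmul_eq_mul]; push_cast; ring
      _ ≤ ∑ n ∈ Q, ((g' n : ℝ) - g n) := Finset.sum_le_sum fun n hn => (hQ n hn).2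
      _ ≤ ∑ n ∈ box d N, ((g' n : ℝ) - g n) := by
          refine Finset.sum_le_sum_of_subset_of_nonneg (fun n hn => (hQ n hn).1) fun n _ _ => ?_
          have : (g n : ℝ) ≤ g' n := by exact_mod_cast hle n
          linarith
  rcases le_or_gt 0 α with hα | hα
  · obtain ⟨h', hh', hout, hsum⟩ := key h hh hS
    exact ⟨h', hh', hout, by rw [abs_of_nonneg hα]; gcongr⟩
  -- For negative `α` the height must be lowered, so the construction is applied to `-h`.
  · obtain ⟨g', hg', hout, hsum⟩ := key _ (Ht.neg hh) fun v hv => by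
      have := hS v hv
      rw [← abs_neg] at this
      convert this using 2
      ring
    refine ⟨_, Ht.neg hg', fun n hn => by rw [hout n hn, neg_neg], ?_⟩
    have e : ∑ n ∈ box d N, (((-g' n : ℤ) : ℝ) - h n)
        = -∑ n ∈ box d N, ((g' n : ℝ) - (-h n : ℤ)) := by
      rw [← Finset.sum_neg_distrib]
      exact Finset.sum_congr rfl fun n _ => by push_cast; ring
    rw [e, abs_of_neg hα, mul_neg, ← neg_mul]
    have : 0 ≤ -α := by linarith
    gcongr

/-- If oscillating points have positive measure, a Radon–Nikodym cocycle has no height part. -/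
theorem height_coefficient_eq_zero [NeZero r] (i : Fin d) (hr1 : r ≠ 1) (hr2 : r ≠ 2)
    [IsProbabilityMeasure μ] (hinv : ShiftInvariant μ) (had : Adapted μ (Xr d r))
    (hpos : μ (oscillating d r) ≠ 0) {M : homoclinic (Xr d r) → ℝ}
    (hRN : HasRadonNikodymCocycle μ M) {α : ℝ} {e : ZMod r → ℝ}
    (hM : ∀ h ∈ Ht d, ∀ h' ∈ Ht d, ∀ F : Finset (Lattice d),
      (∀ n ∉ F, h n = h' n) → ∀ hxy : (red r h, red r h') ∈ homoclinic (Xr d r),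
        M ⟨_, hxy⟩ = α * ∑ n ∈ F, ((h' n : ℝ) - h n) +
          gibbsCocycle (edgeInteraction i (cycleWeight e)) ⟨_, hxy⟩) : α = 0 := by
  classical
  by_contra hα
  have hd : 0 < d := i.pos
  have hr0 := NeZero.ne r
  obtain ⟨K, hK, ε, hε, hN⟩ := exists_stepCount_bound hinv hpos
  set c : ℝ := ∑ a, |e a| with hc
  have hc0 : 0 ≤ c := Finset.sum_nonneg fun _ _ => abs_nonneg _
  -- With `N = 4 K d u + K`, the first factor counts the patterns on the box and the second bounds
  -- the mass of each. The interaction part is at most `2 c` per edge, hence of volume order, while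
  -- the height part has the extra factor `u`.
  have bound : ∀ u : ℕ, 0 < u → ε ≤ (r : ℝ) ^ (2 * (2 * K * (2 * d * u) + K) + 1) ^ d *
      Real.exp (2 * c * ((2 * (2 * K * (2 * d * u) + K) + 1) ^ d : ℕ) -
        |α| * (((u : ℝ) + 1) ^ d * u)) := by
    intro u hu
    set N : ℕ := 2 * K * (2 * d * u) + K with hNdef
    set E : Set (Config d (ZMod r)) := {x | ∀ v, l1dist 0 v = 1 → ∀ s : ℤ, s = 1 ∨ s = -1 →
      2 * K * (2 * d * u) ≤ 2 * K * stepCount x v s N} with hE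
    have hεE : ε ≤ μ.real E := hN _ (by positivity)
    set B : ℝ := Real.exp (2 * c * ((2 * N + 1) ^ d : ℕ) - |α| * (((u : ℝ) + 1) ^ d * u)) with hB
    have hcyl : ∀ x ∈ E ∩ μ.support, μ.real (cyl (box d N) ((box d N).restrict x)) ≤ B := by
      rintro x ⟨hxE, hxs⟩
      obtain ⟨h, hh, rfl⟩ := exists_red_eq (had.1 hxs)
      have hslack : ∀ v, l1dist 0 v = 1 → |h (N • v) - h 0| ≤ N - 2 * (2 * d * u : ℕ) :=
        fun v hv => abs_sub_le_of_stepCount hr0 hr1 hr2 hh hv fun s hs =>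
          Nat.le_of_mul_le_mul_left (hxE v hv s hs) (by positivity)
      have huN : 2 * d * u ≤ N := by
        have : 2 * d * u ≤ 2 * K * (2 * d * u) := Nat.le_mul_of_pos_left _ (by positivity)
        omega
      obtain ⟨h', hh', hout, hgain⟩ := Ht.exists_gain hh α hd huN hslack
      have hin : ∀ n, h n ≠ h' n → ∀ j, |n j| < (N : ℤ) := by
        intro n hn
        by_contra hc
        push Not at hc
        exact hn (hout n hc).symm
      have hbox : ∀ n ∉ box d N, h n = h' n := fun n hn => by
        by_contra hc
        exact hn (mem_box.2 fun j => (hin n hc j).le)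
      have hfin : {n | h n ≠ h' n}.Finite := (box d N).finite_toSet.subset fun n hn => by
        by_contra hc; exact hn (hbox n hc)
      have hxy := homoclinic_red (r := r) hh hh' hfin
      have hys : red r h' ∈ μ.support := had.2 _ hxs _ hxy
      have hred : ∀ n, red r h n ≠ red r h' n → h n ≠ h' n := fun n hn hc =>
        hn (by simp only [red, hc])
      have hnear : ∀ n m : Lattice d, red r h n ≠ red r h' n → l1dist n m ≤ 1 → m ∈ box d N := by
        intro n m hn hnm
        rw [mem_box]
        intro j
        have h1 := hin n (hred n hn) j
        have h2 := abs_sub_le_l1dist n m j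
        have h3 := abs_sub_abs_le_abs_sub (m j) (n j)
        rw [abs_sub_comm] at h3
        omega
      have hratio := hRN _ _ hxy hxs hys hxy.2.2.toFinset (box d N) (fun n => by simp) (by
        intro m hm
        rw [Finset.mem_union, mem_boundary] at hm
        rcases hm with hm | ⟨_, n, hn, hnm⟩
        · simp only [Set.Finite.mem_toFinset] at hm
          exact hnear m m hm (by rw [l1dist_self]; norm_num)
        · simp only [Set.Finite.mem_toFinset] at hn
          exact hnear n m hn hnm.le)
      have hMval := hM h hh h' hh' (box d N) hbox hxy
      have hgibbs : -(2 * c * ((2 * N + 1) ^ d : ℕ)) ≤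
          gibbsCocycle (edgeInteraction i (cycleWeight e)) ⟨_, hxy⟩ := by
        rw [gibbsCocycle_edgeInteraction i _ hxy (box d N) fun k hk =>
          ⟨hnear k k hk (by rw [l1dist_self]; norm_num), hnear k _ hk (by
            rw [l1dist_comm]
            have := l1dist_add_basisVec i (k - basisVec i)
            rw [sub_add_cancel] at this
            exact this.le)⟩]
        calc -(2 * c * ((2 * N + 1) ^ d : ℕ)) = ∑ k ∈ box d N, -(2 * c) := by
              rw [Finset.sum_const, card_box, nsmul_eq_mul]; ring
          _ ≤ _ := Finset.sum_le_sum fun k _ => by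
              have h1 := abs_le.1 (abs_cycleWeight_le e (red r h' k) (red r h' (k + basisVec i)))
              have h2 := abs_le.1 (abs_cycleWeight_le e (red r h k) (red r h (k + basisVec i)))
              linarith [h1.1, h2.2]
      have px := cyl_real_pos hxs (box d N)
      have py : μ.real (cyl (box d N) ((box d N).restrict (red r h'))) ≤ 1 := measureReal_le_one
      rw [div_eq_iff px.ne'] at hratio
      have hle : Real.exp (M ⟨_, hxy⟩) * μ.real (cyl (box d N) ((box d N).restrict (red r h))) ≤ 1 :=
        hratio ▸ py
      -- The modified configuration is likelier by the factor `e^M ≥ 1 / B`, but its cylinder has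
      -- mass at most 1.
      have hBM : 1 ≤ B * Real.exp (M ⟨_, hxy⟩) := by
        rw [hB, ← Real.exp_add]
        exact Real.one_le_exp (by rw [hMval]; linarith)
      have hB0 : 0 < B := Real.exp_pos _
      calc _ ≤ (B * Real.exp (M ⟨_, hxy⟩)) *
            μ.real (cyl (box d N) ((box d N).restrict (red r h))) :=
            le_mul_of_one_le_left px.le hBM
        _ = B * (Real.exp (M ⟨_, hxy⟩) *
            μ.real (cyl (box d N) ((box d N).restrict (red r h)))) := by ring
        _ ≤ B * 1 := by gcongr
        _ = B := mul_one B
    let P : Finset (box d N → ZMod r) :=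
      Finset.univ.filter fun p => p ∈ (box d N).restrict '' (E ∩ μ.support)
    have hP : P.card ≤ r ^ (2 * N + 1) ^ d := by
      refine (Finset.card_filter_le _ _).trans (le_of_eq ?_)
      rw [Finset.card_univ, Fintype.card_fun, ZMod.card, Fintype.card_coe, card_box]
    calc ε ≤ μ.real E := hεE
      _ = μ.real (E ∩ μ.support) := by
          refine measureReal_congr ?_
          have hs : μ.support ∈ ae μ := Measure.support_mem_ae
          filter_upwards [hs] with x hx
          exact propext ⟨fun h => ⟨h, hx⟩, fun h => h.1⟩
      _ ≤ μ.real (⋃ p ∈ P, cyl (box d N) p) := by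
          refine measureReal_mono (fun x hx => ?_) (measure_ne_top _ _)
          exact Set.mem_biUnion (x := (box d N).restrict x)
            (Finset.mem_filter.2 ⟨Finset.mem_univ _, x, hx, rfl⟩) rfl
      _ ≤ ∑ p ∈ P, μ.real (cyl (box d N) p) := measureReal_biUnion_finset_le _ _
      _ ≤ ∑ _p ∈ P, B := Finset.sum_le_sum fun p hp => by
          obtain ⟨x, hx, rfl⟩ := (Finset.mem_filter.1 hp).2
          exact hcyl x hx
      _ = P.card * B := by rw [Finset.sum_const, nsmul_eq_mul]
      _ ≤ (r : ℝ) ^ (2 * N + 1) ^ d * B := by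
          gcongr
          exact_mod_cast hP
  have hlogr : 0 ≤ Real.log r := Real.log_natCast_nonneg r
  set C : ℝ := ((8 * K * d + 2 * K + 1 : ℕ) : ℝ) ^ d with hC
  have hα' : 0 < |α| := abs_pos.2 hα
  -- Here `C` satisfies `(2 N + 1)^d ≤ C (w + 1)^d`. Once `|α| w` exceeds `C (log r + 2 c)` by `1 +
  -- |log ε|`, the exponent is at most `-(1 + |log ε|)`, so the bound would give `log ε ≤ -1 - |log
  -- ε|`.
  obtain ⟨u, hu⟩ := exists_nat_ge ((C * (Real.log r + 2 * c) + (1 + |Real.log ε|)) / |α|)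
  set w : ℕ := u + 1 with hw
  have hw' : C * (Real.log r + 2 * c) + (1 + |Real.log ε|) ≤ |α| * w := by
    rw [div_le_iff₀ hα'] at hu
    rw [hw]; push_cast
    nlinarith
  have hb := bound w (by omega)
  set T : ℕ := (2 * (2 * K * (2 * d * w) + K) + 1) ^ d with hT
  set V : ℝ := ((w : ℝ) + 1) ^ d with hV
  have hV1 : 1 ≤ V := one_le_pow₀ (by linarith [Nat.cast_nonneg (α := ℝ) w])
  have hTV : (T : ℝ) ≤ C * V := by
    rw [hT, hC, hV, ← mul_pow]
    push_cast
    refine pow_le_pow_left₀ (by positivity) ?_ d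
    have h1 : (0 : ℝ) ≤ K := Nat.cast_nonneg _
    have h2 : (0 : ℝ) ≤ w := Nat.cast_nonneg _
    have h3 : (0 : ℝ) ≤ K * d := by positivity
    have h4 : (0 : ℝ) ≤ K * w := by positivity
    nlinarith
  have hrpow : (r : ℝ) ^ T = Real.exp (T * Real.log r) := by
    rw [mul_comm, Real.exp_mul, Real.exp_log (by exact_mod_cast Nat.pos_of_ne_zero hr0),
      Real.rpow_natCast]
  rw [hrpow, ← Real.exp_add] at hb
  have hexp : T * Real.log r + (2 * c * T - |α| * (V * w)) ≤ -(1 + |Real.log ε|) := by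
    have h1 : (T : ℝ) * (Real.log r + 2 * c) ≤ C * V * (Real.log r + 2 * c) := by gcongr
    have h2 : V * (C * (Real.log r + 2 * c) + (1 + |Real.log ε|)) ≤ V * (|α| * w) := by gcongr
    have h3 : 1 + |Real.log ε| ≤ V * (1 + |Real.log ε|) :=
      le_mul_of_one_le_left (by positivity) hV1
    linarith
  have hlog := (Real.log_le_iff_le_exp hε).2 hb
  have := neg_abs_le (Real.log ε)
  linarith

end HeightPart

/-! ### Fields that are not frozen -/

section Main

variable {d r : ℕ} {μ : Measure (Config d (ZMod r))}

/-- For a field that is not frozen, a Radon–Nikodym cocycle is a Gibbs cocycle. -/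
theorem isShiftInvariantGibbsCocycle_of_not_frozen [NeZero r] (hd : 2 ≤ d) (hr1 : r ≠ 1)
    (hr2 : r ≠ 2) (hμ : IsMRF μ) (hinv : ShiftInvariant μ) (had : Adapted μ (Xr d r))
    (hpos : μ (oscillating d r) ≠ 0) {M : homoclinic (Xr d r) → ℝ}
    (hM : IsShiftInvariantMarkovCocycle M) (hRN : HasRadonNikodymCocycle μ M) :
    IsShiftInvariantGibbsCocycle M := by
  have := hμ.prob
  let i : Fin d := ⟨0, by omega⟩
  obtain ⟨α, e, hstr⟩ := markovCocycle_structure hr1 hr2 i hM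
  have hα : α = 0 := height_coefficient_eq_zero i hr1 hr2 hinv had hpos hRN hstr
  refine ⟨edgeInteraction i (cycleWeight e), edgeInteraction_isNearestNeighbor _ _,
    edgeInteraction_isShiftInvariant _ _, funext ?_⟩
  rintro ⟨⟨x, y⟩, hxy⟩
  obtain ⟨h, hh, h', hh', rfl, rfl, hfin⟩ := exists_lift_pair hd (NeZero.ne r) hr1 hr2 hxy
  rw [hstr h hh h' hh' hfin.toFinset (fun n hn => by simpa using hn) hxy, hα, zero_mul, zero_add]

/-- The interaction that vanishes identically. -/
noncomputable def zeroInteraction (X : Set (Config d (ZMod r))) : Interaction X := fun _ _ => 0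

theorem gibbsCocycle_zeroInteraction {X : Set (Config d (ZMod r))} (p : homoclinic X) :
    gibbsCocycle (zeroInteraction X) p = 0 := by
  simp [gibbsCocycle, zeroInteraction]

/-- A shift-invariant Markov random field adapted to `X_r` is a Gibbs state. -/
theorem exists_isGibbsState_of_adapted [NeZero r] (hd : 2 ≤ d) (hr1 : r ≠ 1) (hr2 : r ≠ 2)
    (hr4 : r ≠ 4) (hμ : IsMRF μ) (hinv : ShiftInvariant μ) (had : Adapted μ (Xr d r)) :
    ∃ φ : Interaction (Xr d r), φ.IsNearestNeighbor ∧ φ.IsShiftInvariant ∧ IsGibbsState φ μ := by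
  have := hμ.prob
  by_cases h0 : μ (oscillating d r) = 0
  · have hfr := frozenMeasure_of_oscillating_null hd hr1 hr2 hinv had.1 h0
    have hnn : (zeroInteraction (Xr d r)).IsNearestNeighbor := fun _ _ _ => rfl
    -- On a frozen support every homoclinic pair is diagonal, so the Radon–Nikodym condition for the
    -- zero cocycle is trivial.
    refine ⟨zeroInteraction _, hnn, fun _ _ _ _ _ => rfl,
      isGibbsState_of_radonNikodym hr1 hr2 hr4 hμ had hnn fun x y hxy hx hy F Λ _ _ => ?_⟩
    obtain rfl := (hfr x hx).2 y hxy
    rw [gibbsCocycle_zeroInteraction, Real.exp_zero, div_self (cyl_real_pos hx Λ).ne']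
  -- Full support is needed here because the Radon–Nikodym cocycle is constructed only on the
  -- support, while the structure theorem concerns cocycles on all of `X_r`.
  · have hsupp := support_eq_Xr_of_oscillating ⟨0, by omega⟩ hr1 hr2 hinv had h0
    obtain ⟨M, hM, hRN⟩ := exists_radonNikodymCocycle hμ hinv hsupp
    obtain ⟨φ, hnn, hsi, rfl⟩ :=
      isShiftInvariantGibbsCocycle_of_not_frozen hd hr1 hr2 hμ hinv had h0 hM hRN
    exact ⟨φ, hnn, hsi, isGibbsState_of_radonNikodym hr1 hr2 hr4 hμ had hnn hRN⟩

end Main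

end ZdField

theorem mainTheorem1 (d r : ℕ) [NeZero r] (hd : 2 ≤ d) (hr1 : r ≠ 1) (hr2 : r ≠ 2) (hr4 : r ≠ 4)
    (μ : Measure (ZdField.Config d (ZMod r))) (hμ : ZdField.IsMRF μ)
    (hinv : ZdField.ShiftInvariant μ) :
    (ZdField.Adapted μ (ZdField.Xr d r) →
      ∃ φ : ZdField.Interaction (ZdField.Xr d r),
        φ.IsNearestNeighbor ∧ φ.IsShiftInvariant ∧ ZdField.IsGibbsState φ μ) ∧
    (μ.support = ZdField.Xr d r →
      ∃ φ : ZdField.Interaction (ZdField.Xr d r),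
        φ.IsNearestNeighbor ∧ φ.IsShiftInvariant ∧ ZdField.IsGibbsState φ μ) ∧
    (ZdField.Adapted μ (ZdField.Xr d r) →
      ∀ M : ZdField.homoclinic (ZdField.Xr d r) → ℝ,
        ZdField.IsShiftInvariantMarkovCocycle M →
        ¬ ZdField.IsShiftInvariantGibbsCocycle M →
        ZdField.HasRadonNikodymCocycle μ M →
          ZdField.FrozenMeasure (ZdField.Xr d r) μ) := by
  have := hμ.prob
  refine ⟨fun had => ZdField.exists_isGibbsState_of_adapted hd hr1 hr2 hr4 hμ hinv had,
    fun hsupp => ZdField.exists_isGibbsState_of_adapted hd hr1 hr2 hr4 hμ hinv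
      ⟨hsupp.le, fun x _ y hxy => hsupp ▸ hxy.2.1⟩, fun had M hM hnot hRN => ?_⟩
  by_contra hfr
  -- A field that is not frozen gives positive mass to the oscillating points, and this forces `M`
  -- to be Gibbs.
  refine hnot (ZdField.isShiftInvariantGibbsCocycle_of_not_frozen hd hr1 hr2 hμ hinv had
    (fun h0 => hfr ?_) hM hRN)
  exact ZdField.frozenMeasure_of_oscillating_null hd hr1 hr2 hinv had.1 h0
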